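/- Let $d\ge 1$, let $F_d$ be the free group of rank $d$ with free basis $a_1,\dots,a_d$, and let $|g|$ denote the reduced word length of $g\in F_d$, i.e. the distance from $1$ to $g$ in the Cayley tree of $F_d$. Endow the set $\mathrm{Sub}(F_d)$ of subgroups of $F_d$ with the Chabauty topology, the subspace topology inherited from $\mathrm{Sub}(F_d)\subset\{0,1\}^{F_d}$. A subgroup $\Delta\le F_d$ is a boomerang subgroup if for every $g\in F_d$ there is a sequence of natural numbers $n_k\to\infty$ with $\lim_{k\to\infty} g^{n_k}\Delta g^{-n_k}=\Delta$; let $\mathrm{Boom}(F_d)$ be the set of all boomerang subgroups of $F_d$. For $\Delta\le F_d$ let $$\delta(\Delta)=\inf\Big\{s>0 \;\Big|\; \sum_{\gamma\in\Delta}e^{-s|\gamma|}<\infty\Big\},\qquad b(\Delta)=e^{\delta(\Delta)}$$ be its critical exponent (for the action on the Cayley tree) and its growth rate. Then $\delta(\mathrm{Boom}(F_d))$ is a dense subset of $[0,\ln(2d-1)]$, and $b(\mathrm{Boom}(F_d))$ is a dense subset of $[1,2d-1]$. -/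

import Mathlib

open Filter Topology Set

/-- The Chabauty topology on `Sub(G)`: the subspace topology inherited from the embedding of
`Sub(G)` into `{0,1}^G` (product of discrete two-point spaces) by indicator functions. -/
noncomputable instance chabautyTopology (G : Type*) [Group G] :
    TopologicalSpace (Subgroup G) :=
  TopologicalSpace.induced
    (fun (H : Subgroup G) (g : G) => (open Classical in decide (g ∈ H) : Bool))
    Pi.topologicalSpace

/-- The conjugate subgroup `g H g⁻¹`. -/
def conjSubgroup {G : Type*} [Group G] (g : G) (H : Subgroup G) : Subgroup G :=
  H.map (MulAut.conj g).toMonoidHom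

/-- `H` is a boomerang subgroup of `G`: for every `g` there is a sequence `n_k → ∞` such that
`g ^ n_k H g ^ (-n_k)` converges to `H` in the Chabauty topology. -/
def IsBoomerang {G : Type*} [Group G] (H : Subgroup G) : Prop :=
  ∀ g : G, ∃ n : ℕ → ℕ, Tendsto n atTop atTop ∧
    Tendsto (fun k => conjSubgroup (g ^ n k) H) atTop (𝓝 H)

/-- `Boom(F_d)`, the set of boomerang subgroups of the free group of rank `d`. -/
def Boom (d : ℕ) : Set (Subgroup (FreeGroup (Fin d))) :=
  {H | IsBoomerang H}

/-- The critical exponent of a subgroup `H` of `F_d` acting on its Cayley tree: the infimum of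
the `s > 0` for which the Poincaré series `∑ exp (-s * d(1, γ))`, over `γ ∈ H`, converges.
The base point is the vertex `1`, so the displacement `d(1, γ)` is the reduced word length
`FreeGroup.norm γ`. The set is bounded below by `0`, and it is nonempty since `F_d` has at most
`(2 * d) ^ n` elements of length `n`. -/
noncomputable def criticalExponent {d : ℕ} (H : Subgroup (FreeGroup (Fin d))) : ℝ :=
  sInf {s : ℝ | 0 < s ∧
    Summable (fun γ : H => Real.exp (-s * (FreeGroup.norm (γ : FreeGroup (Fin d)) : ℝ)))}

/-- The growth rate `b(H) = e ^ δ(H)` of a subgroup `H` of `F_d`. -/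
noncomputable def growthRate {d : ℕ} (H : Subgroup (FreeGroup (Fin d))) : ℝ :=
  Real.exp (criticalExponent H)

/-- `S` is a dense subset of the set `T` of real numbers. -/
def IsDenseIn (S T : Set ℝ) : Prop :=
  S ⊆ T ∧ T ⊆ closure S

/-! The upper bound on critical exponents is word counting: the Poincaré series of the whole group
converges for `s > log (2d - 1)`. Density combines two facts: finitely generated subgroups have
dense critical exponents, and each lies in a boomerang subgroup whose exponent is as little larger
as desired.

For the second fact (`exists_isBoomerang_criticalExponent`), fix `s` just above the exponent of `H`
and enumerate the group. Whenever the current finitely generated subgroup contains no nontrivial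
power of the next element `g`, adjoin a high power `g ^ n`. The axis of `g` overlaps its nontrivial
translates by that subgroup boundedly (`exists_gromov_zpow_lt`), so alternating products have almost
additive length, and the series at `s` is multiplied by at most a geometric series of ratio tending
to `0` as `n` grows. The union contains a positive power of every element, hence is a boomerang, and
its series at `s` still converges.

For the first fact (`exists_fg_criticalExponent`), take a finite quotient whose Cayley graph has
girth larger than `N`. Stretching its edges, with labels repeated, embeds the kernel in the free
group by an immersion of graphs. Unit lengths give the exponent `q = log (2d - 1)`, constant lengths
`N` give at most `q / N`, and lengthening one edge by `1` lowers the exponent at most by a factor `1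
+ 1 / N`, since reduced paths cross an edge rarely. A discrete intermediate value argument
concludes. -/

open scoped ENNReal

/-! ### Gromov products and powers in the Cayley tree -/

section WordGeometry

variable {α : Type*} [DecidableEq α]

/-- The length of the longest common prefix of two lists. -/
def lcpLength {β : Type*} [DecidableEq β] : List β → List β → ℕ
  | a :: l, b :: m => if a = b then lcpLength l m + 1 else 0
  | _, _ => 0

theorem min_lcpLength_le {β : Type*} [DecidableEq β] (l m k : List β) :
    min (lcpLength l m) (lcpLength m k) ≤ lcpLength l k := by
  induction l generalizing m k with
  | nil => simp [lcpLength]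
  | cons a l ih =>
    cases m with
    | nil => simp [lcpLength]
    | cons b m =>
      cases k with
      | nil => simp [lcpLength]
      | cons c k =>
        have := ih m k
        by_cases hab : a = b <;> by_cases hbc : b = c <;> by_cases hac : a = c <;>
          simp_all [lcpLength]

namespace FreeGroup

theorem IsReduced.invRev_isReduced {L : List (α × Bool)} (h : IsReduced L) :
    IsReduced (invRev L) := by
  rw [isReduced_iff_reduce_eq, reduce_invRev, h.reduce_eq]

theorem length_reduce_invRev_append {L M : List (α × Bool)} (hL : IsReduced L)
    (hM : IsReduced M) :
    (reduce (invRev L ++ M)).length + 2 * lcpLength L M = L.length + M.length := by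
  induction L generalizing M with
  | nil => simp [lcpLength, hM.reduce_eq]
  | cons a L ih =>
    cases M with
    | nil =>
      rw [List.append_nil, hL.invRev_isReduced.reduce_eq]
      simp [lcpLength]
    | cons b M =>
      by_cases hab : a = b
      · subst hab
        have hred : reduce (invRev (a :: L) ++ a :: M) = reduce (invRev L ++ M) := by
          apply reduce.sound
          have h1 : (mk (a :: L) : FreeGroup α) = mk [a] * mk L := by simp
          have h2 : (mk (a :: M) : FreeGroup α) = mk [a] * mk M := by simp
          rw [← mul_mk, ← mul_mk, ← inv_mk, ← inv_mk, h1, h2]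
          group
        have := ih (hL.infix (List.suffix_cons a L).isInfix) (hM.infix (List.suffix_cons a M).isInfix)
        rw [hred]
        simp only [lcpLength, List.length_cons, if_true]
        omega
      · have hred : IsReduced (invRev (a :: L) ++ b :: M) := by
          have h1 : IsReduced (invRev L ++ [(a.1, !a.2)]) := by
            have := hL.invRev_isReduced
            rw [invRev_cons] at this
            simpa [invRev] using this
          have h2 : IsReduced ([(a.1, !a.2)] ++ b :: M) := by
            rw [List.singleton_append, isReduced_cons_cons]
            refine ⟨fun h => ?_, hM⟩
            by_contra hne
            apply hab
            ext
            · exact h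
            · cases ha : a.2 <;> cases hb : b.2 <;> simp_all
          have := h1.append_overlap h2 (by simp)
          rw [invRev_cons]
          simpa [invRev] using this
        rw [hred.reduce_eq]
        simp [lcpLength, hab]

/-- Twice the Gromov product of two elements of a free group, with base point `1`. -/
def gromov (x y : FreeGroup α) : ℤ := norm x + norm y - norm (x⁻¹ * y)

theorem gromov_eq (x y : FreeGroup α) : gromov x y = 2 * lcpLength x.toWord y.toWord := by
  have := length_reduce_invRev_append (isReduced_toWord (x := x)) (isReduced_toWord (x := y))
  rw [gromov, norm, norm, norm, toWord_mul, toWord_inv]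
  omega

/-- This is 0-hyperbolicity of the tree: the Gromov product is a common prefix length, and such
lengths are ultrametric. All later tripod arguments rest on it. -/
theorem min_gromov_le (x y z : FreeGroup α) : min (gromov x y) (gromov y z) ≤ gromov x z := by
  rw [gromov_eq, gromov_eq, gromov_eq]
  have := min_lcpLength_le x.toWord y.toWord z.toWord
  omega

theorem norm_inv_mul_comm (x y : FreeGroup α) : norm (x⁻¹ * y) = norm (y⁻¹ * x) := by
  rw [← norm_inv_eq]; congr 1; group

theorem gromov_comm (x y : FreeGroup α) : gromov x y = gromov y x := by
  rw [gromov, gromov, norm_inv_mul_comm]; ring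

theorem gromov_le_left (x y : FreeGroup α) : gromov x y ≤ 2 * norm x := by
  have : norm y ≤ norm x + norm (x⁻¹ * y) := by
    simpa using norm_mul_le x (x⁻¹ * y)
  rw [gromov]; omega

/-- In a group generated by elements of norm at most `D`, some element lies within `D + E` of any
point which is close to a geodesic from `1` to an element of the group. -/
theorem exists_mem_norm_le_of_gromov {S : Set (FreeGroup α)} {D E : ℤ} (hD : 0 ≤ D)
    (hS : ∀ x ∈ S, norm x ≤ D) {h : FreeGroup α} (hh : h ∈ Subgroup.closure S) (p : FreeGroup α)
    (hp : 2 * norm p - 2 * E ≤ gromov p h) :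
    ∃ h' ∈ Subgroup.closure S, norm (h'⁻¹ * p) ≤ D + E := by
  by_cases hpE : norm p ≤ E
  · exact ⟨1, one_mem _, by simp; omega⟩
  -- Along a word in the generators the product with `p` starts at `0`. At the step where it first
  -- passes the threshold, `x` and `x * y` branch apart before the threshold, so `x * y` exceeds it
  -- in norm by at most `D` and is close to `p`.
  have step : ∀ x y : FreeGroup α, norm y ≤ D → gromov p x < 2 * norm p - 2 * E →
      2 * norm p - 2 * E ≤ gromov p (x * y) → norm ((x * y)⁻¹ * p) ≤ D + E := by
    intro x y hy hx hxy
    have h1 := min_gromov_le p (x * y) x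
    have h2 : gromov (x * y) x < 2 * norm p - 2 * E := by
      rcases min_le_iff.1 h1 with h | h <;> omega
    have h3 : norm ((x * y)⁻¹ * x) = norm y := by
      rw [← norm_inv_eq (x := y)]; congr 1; group
    have h4 := norm_mul_le x y
    have h5 : norm x ≤ norm (x * y) + norm y := by
      simpa using norm_mul_le (x * y) y⁻¹
    have h6 : norm (x * y) ≤ D + norm p - E := by
      unfold gromov at h2
      omega
    rw [norm_inv_mul_comm]
    unfold gromov at hxy
    omega
  have key : gromov p h < 2 * norm p - 2 * E ∨
      ∃ h' ∈ Subgroup.closure S, norm (h'⁻¹ * p) ≤ D + E := by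
    clear hp
    induction hh using Subgroup.closure_induction_right with
    | one => left; simp [gromov]; omega
    | mul_right x hx y hy ih =>
      rcases ih with ih | ih
      · by_cases hc : gromov p (x * y) < 2 * norm p - 2 * E
        · exact Or.inl hc
        · exact Or.inr ⟨x * y, mul_mem hx (Subgroup.subset_closure hy),
            step x y (hS y hy) ih (not_lt.1 hc)⟩
      · exact Or.inr ih
    | mul_inv_cancel x hx y hy ih =>
      rcases ih with ih | ih
      · by_cases hc : gromov p (x * y⁻¹) < 2 * norm p - 2 * E
        · exact Or.inl hc
        · exact Or.inr ⟨x * y⁻¹, mul_mem hx (inv_mem (Subgroup.subset_closure hy)),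
            step x y⁻¹ (by rw [norm_inv_eq]; exact hS y hy) ih (not_lt.1 hc)⟩
      · exact Or.inr ih
  rcases key with h | h
  · omega
  · exact h

/-- The norms of the powers of an element of a free group grow affinely. -/
theorem exists_norm_pow_eq (g : FreeGroup α) (hg : g ≠ 1) :
    ∃ u c : ℕ, 0 < c ∧ ∀ m : ℕ, m ≠ 0 → norm (g ^ m) = 2 * u + m * c := by
  -- Write `g` as a conjugate of its cyclically reduced core: powers repeat the core and keep the
  -- conjugator.
  refine ⟨(reduceCyclically.conjugator g.toWord).length,
    (reduceCyclically g.toWord).length, ?_, fun m hm => ?_⟩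
  · rw [List.length_pos_iff]
    intro h
    apply hg
    have := reduceCyclically.conj_conjugator_reduceCyclically g.toWord
    rw [h, List.append_nil] at this
    rw [← mk_toWord (x := g), ← this, ← mul_mk, ← inv_mk, mul_inv_cancel]
  · rw [norm, toWord_pow, reduceCyclically.reduce_flatten_replicate isReduced_toWord, if_neg hm]
    simp
    ring

theorem le_norm_pow {g : FreeGroup α} (hg : g ≠ 1) (m : ℕ) : m ≤ norm (g ^ m) := by
  obtain ⟨u, c, hc, h⟩ := exists_norm_pow_eq g hg
  rcases Nat.eq_zero_or_pos m with rfl | hm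
  · simp
  · rw [h m hm.ne']
    nlinarith

theorem norm_zpow_natAbs (g : FreeGroup α) (k : ℤ) : norm (g ^ k) = norm (g ^ k.natAbs) := by
  rcases Int.natAbs_eq k with h | h
  · conv_lhs => rw [h, zpow_natCast]
  · conv_lhs => rw [h, zpow_neg, zpow_natCast, norm_inv_eq]

theorem natAbs_le_norm_zpow {g : FreeGroup α} (hg : g ≠ 1) (k : ℤ) : k.natAbs ≤ norm (g ^ k) := by
  rw [norm_zpow_natAbs]; exact le_norm_pow hg _

/-- Powers of `g` lie uniformly close to geodesics between other powers. -/
theorem exists_gromov_pow_pow (g : FreeGroup α) :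
    ∃ E : ℤ, 0 ≤ E ∧ ∀ i j : ℕ, i ≤ j → 2 * norm (g ^ i) - 2 * E ≤ gromov (g ^ i) (g ^ j) := by
  by_cases hg : g = 1
  · exact ⟨0, le_rfl, fun i j _ => by simp [hg, gromov]⟩
  obtain ⟨u, c, hc, h⟩ := exists_norm_pow_eq g hg
  refine ⟨2 * u + 1, by positivity, fun i j hij => ?_⟩
  obtain ⟨k, rfl⟩ := Nat.exists_eq_add_of_le hij
  have hk : (g ^ i)⁻¹ * g ^ (i + k) = g ^ k := by rw [pow_add]; group
  rw [gromov, hk]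
  rcases Nat.eq_zero_or_pos i with rfl | hi
  · simp; omega
  rcases Nat.eq_zero_or_pos k with rfl | hk'
  · simp; omega
  rw [h i hi.ne', h k hk'.ne', h (i + k) (by omega)]
  push_cast
  nlinarith

end FreeGroup

end WordGeometry

/-! ### Bounded overlap of an axis with its translates -/

section Overlap

variable {α : Type*} [DecidableEq α]

namespace FreeGroup

theorem finite_norm_le [Finite α] (n : ℕ) : {x : FreeGroup α | norm x ≤ n}.Finite :=
  Set.Finite.of_finite_image
    ((List.finite_length_le (α × Bool) n).subset (by rintro _ ⟨x, hx, rfl⟩; exact hx))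
    toWord_injective.injOn

theorem not_commute_of {α : Type*} {a b : α} (hab : a ≠ b) : ¬ Commute (of a) (of b) := by
  classical
  intro h
  have := congrArg toWord h.eq
  rw [toWord_mul, toWord_mul, toWord_of, toWord_of] at this
  simp [reduce.cons, hab, hab.symm] at this

/-- A commutative free group is cyclic. -/
theorem _root_.IsFreeGroup.isCyclic_of_commute {G : Type*} [Group G] [IsFreeGroup G]
    (h : ∀ x y : G, Commute x y) : IsCyclic G := by
  have hsub : Subsingleton (IsFreeGroup.Generators G) := by
    refine ⟨fun a b => ?_⟩
    by_contra hab
    apply not_commute_of hab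
    have := (h ((IsFreeGroup.toFreeGroup G).symm (of a)) ((IsFreeGroup.toFreeGroup G).symm (of b))).map
      (IsFreeGroup.toFreeGroup G)
    simpa using this
  have : IsCyclic (FreeGroup (IsFreeGroup.Generators G)) := by
    rcases isEmpty_or_nonempty (IsFreeGroup.Generators G) with he | ⟨⟨a⟩⟩
    · infer_instance
    · have : Unique (IsFreeGroup.Generators G) := ⟨⟨a⟩, fun b => Subsingleton.elim _ _⟩
      infer_instance
  exact isCyclic_of_surjective (IsFreeGroup.toFreeGroup G).symm (IsFreeGroup.toFreeGroup G).symm.surjective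

/-- Commuting elements of a free group are powers of a common element. -/
theorem exists_zpow_of_commute {α : Type*} {x y : FreeGroup α} (h : Commute x y) :
    ∃ (z : FreeGroup α) (p q : ℤ), x = z ^ p ∧ y = z ^ q := by
  have hcomm : ∀ a ∈ ({x, y} : Set (FreeGroup α)), ∀ b ∈ ({x, y} : Set (FreeGroup α)),
      a * b = b * a := by
    rintro a (rfl | rfl) b (rfl | rfl)
    · rfl
    · exact h.eq
    · exact h.eq.symm
    · rfl
  have hc : ∀ a b : Subgroup.closure ({x, y} : Set (FreeGroup α)), Commute a b := by
    have := Subgroup.isMulCommutative_closure hcomm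
    exact fun a b => mul_comm' a b
  -- By Nielsen–Schreier the subgroup generated by `x` and `y` is free; being commutative, it is
  -- cyclic.
  obtain ⟨z, hz⟩ := IsFreeGroup.isCyclic_of_commute hc
  obtain ⟨p, hp⟩ := hz ⟨x, Subgroup.subset_closure (by simp)⟩
  obtain ⟨q, hq⟩ := hz ⟨y, Subgroup.subset_closure (by simp)⟩
  exact ⟨z, p, q, by simpa using (congrArg Subtype.val hp).symm,
    by simpa using (congrArg Subtype.val hq).symm⟩

/-- If `h` conjugates a power of `g` to a power of `g`, the exponents agree up to sign. -/
theorem natAbs_le_of_conj_zpow {g h : FreeGroup α} (hg : g ≠ 1) {a b : ℤ}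
    (hab : h * g ^ a * h⁻¹ = g ^ b) : b.natAbs ≤ a.natAbs := by
  by_contra hlt
  rw [not_le] at hlt
  -- Iterating the relation bounds the norm of `g ^ (b ^ r)` by a linear term plus a multiple of
  -- `|a| ^ r`, whereas it is at least `|b| ^ r`. This is impossible for large `r` if `|b| > |a|`.
  have hiter : ∀ r : ℕ, h ^ r * g ^ (a ^ r) * (h ^ r)⁻¹ = g ^ (b ^ r) := by
    intro r
    induction r with
    | zero => simp
    | succ r ih =>
      calc h ^ (r + 1) * g ^ (a ^ (r + 1)) * (h ^ (r + 1))⁻¹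
          = h ^ r * (h * g ^ a * h⁻¹) ^ (a ^ r) * (h ^ r)⁻¹ := by
            rw [conj_zpow, ← zpow_mul, ← pow_succ' a, pow_succ h]; group
        _ = (h ^ r * g ^ (a ^ r) * (h ^ r)⁻¹) ^ b := by
            rw [hab, conj_zpow, ← zpow_mul, ← zpow_mul, mul_comm]
        _ = g ^ (b ^ (r + 1)) := by rw [ih, ← zpow_mul, pow_succ]
  have hpow : ∀ r : ℕ, norm (h ^ r) ≤ r * norm h := by
    intro r
    induction r with
    | zero => simp
    | succ r ih =>
      rw [pow_succ]
      have := norm_mul_le (h ^ r) h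
      nlinarith
  have hzpow : ∀ m : ℕ, norm (g ^ m) ≤ m * norm g := by
    intro r
    induction r with
    | zero => simp
    | succ r ih =>
      rw [pow_succ]
      have := norm_mul_le (g ^ r) g
      nlinarith
  have hbound : ∀ r : ℕ, b.natAbs ^ r ≤ 2 * (r * norm h) + a.natAbs ^ r * norm g := by
    intro r
    have h1 := natAbs_le_norm_zpow hg (b ^ r)
    rw [← hiter r, Int.natAbs_pow] at h1
    have h2 := norm_mul_le (h ^ r * g ^ (a ^ r)) (h ^ r)⁻¹
    have h3 := norm_mul_le (h ^ r) (g ^ (a ^ r))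
    have h4 := hpow r
    have h5 := hzpow (a ^ r).natAbs
    rw [← norm_zpow_natAbs, Int.natAbs_pow] at h5
    rw [norm_inv_eq] at h2
    omega
  have hb0 : (0 : ℝ) < b.natAbs := by
    have : 0 < b.natAbs := by omega
    exact_mod_cast this
  have hb1 : (1 : ℝ) < b.natAbs := by
    rcases Nat.eq_zero_or_pos a.natAbs with ha | ha
    · rw [Int.natAbs_eq_zero] at ha
      subst ha
      have : b = 0 := (IsMulTorsionFree.zpow_eq_one_iff_right hg).1 (by simpa using hab.symm)
      simp [this] at hb0
    · have : 1 < b.natAbs := by omega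
      exact_mod_cast this
  have hle : ∀ r : ℕ, (1 : ℝ) ≤ 2 * norm h * (r * (b.natAbs : ℝ)⁻¹ ^ r) +
      ((a.natAbs : ℝ) / b.natAbs) ^ r * norm g := by
    intro r
    have h1 : ((b.natAbs : ℝ)) ^ r ≤ 2 * (r * norm h) + (a.natAbs : ℝ) ^ r * norm g := by
      exact_mod_cast hbound r
    have h2 : (0 : ℝ) < (b.natAbs : ℝ) ^ r := by positivity
    have h3 := div_le_div_of_nonneg_right h1 h2.le
    rw [div_self h2.ne'] at h3
    refine h3.trans_eq ?_
    rw [div_pow, inv_pow]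
    ring
  have ht1 : Tendsto (fun r : ℕ => (r : ℝ) * (b.natAbs : ℝ)⁻¹ ^ r) atTop (𝓝 0) :=
    tendsto_self_mul_const_pow_of_lt_one (by positivity) (inv_lt_one_of_one_lt₀ hb1)
  have ht2 : Tendsto (fun r : ℕ => ((a.natAbs : ℝ) / b.natAbs) ^ r) atTop (𝓝 0) := by
    apply tendsto_pow_atTop_nhds_zero_of_lt_one (by positivity)
    rw [div_lt_one hb0]
    exact_mod_cast hlt
  have ht := (ht1.const_mul (2 * (norm h : ℝ))).add (ht2.mul_const (norm g : ℝ))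
  have := ge_of_tendsto' ht hle
  norm_num at this

/-- If `h` conjugates a nontrivial power of `g` to a power of `g`, then `h ^ 2` commutes
with `g`. -/
theorem commute_sq_of_conj_zpow {g h : FreeGroup α} (hg : g ≠ 1) {a b : ℤ} (ha : a ≠ 0)
    (hab : h * g ^ a * h⁻¹ = g ^ b) : Commute (h ^ 2) g := by
  have h1 := natAbs_le_of_conj_zpow hg hab
  have h2 : a.natAbs ≤ b.natAbs := natAbs_le_of_conj_zpow (h := h⁻¹) hg (by rw [← hab]; group)
  have hconj : (h * g * h⁻¹) ^ a = g ^ b := by rw [conj_zpow, hab]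
  -- Roots are unique in a free group.
  have hcases : h * g * h⁻¹ = g ∨ h * g * h⁻¹ = g⁻¹ := by
    rcases Int.natAbs_eq_natAbs_iff.1 (le_antisymm h1 h2) with rfl | rfl
    · exact Or.inl (zpow_left_injective ha hconj)
    · exact Or.inr (zpow_left_injective ha (by simpa using hconj))
  have hsq : h ^ 2 * g * (h ^ 2)⁻¹ = h * (h * g * h⁻¹) * h⁻¹ := by
    rw [pow_two]; group
  rw [commute_iff_eq, ← mul_inv_eq_iff_eq_mul, hsq]
  rcases hcases with hc | hc
  · rw [hc, hc]
  · rw [hc]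
    have := congrArg (·⁻¹) hc
    simpa [mul_assoc] using this

/-- A subgroup containing a nontrivial element which conjugates a nontrivial power of `g` to a
power of `g` contains a nontrivial power of `g`. -/
theorem exists_pow_mem_of_conj_zpow {H : Subgroup (FreeGroup α)} {g h : FreeGroup α} (hg : g ≠ 1)
    (hh : h ∈ H) (hh1 : h ≠ 1) {a b : ℤ} (ha : a ≠ 0) (hab : h * g ^ a * h⁻¹ = g ^ b) :
    ∃ p : ℤ, p ≠ 0 ∧ g ^ p ∈ H := by
  obtain ⟨z, p, q, hp, hq⟩ := exists_zpow_of_commute (commute_sq_of_conj_zpow hg ha hab)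
  have hsq : h ^ 2 ≠ 1 := fun h2 => hh1 ((pow_eq_one_iff_left two_ne_zero).1 h2)
  have hp0 : p ≠ 0 := by
    rintro rfl
    exact hsq (by simpa using hp)
  refine ⟨p, hp0, ?_⟩
  have : g ^ p = (h ^ 2) ^ q := by rw [hp, hq, ← zpow_mul, ← zpow_mul, mul_comm]
  rw [this]
  exact zpow_mem (pow_mem hh 2) q

/-- A long overlap puts many powers `g ^ i` near the geodesic from `1` to `h * g ^ k`, hence near
`H` or near the coset of `h` by the powers of `g`. By pigeonhole two of them differ from such points
by the same short element. Either a power of `g` then lies in `H`, or `h` conjugates a power of `g`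
to a power of `g`; both are excluded. -/
theorem exists_gromov_pow_lt [Finite α] {H : Subgroup (FreeGroup α)} (hH : H.FG)
    {g : FreeGroup α} (hg : ∀ p : ℤ, p ≠ 0 → g ^ p ∉ H) :
    ∃ C : ℤ, ∀ h ∈ H, h ≠ 1 → ∀ (j : ℕ) (k : ℤ), gromov (g ^ j) (h * g ^ k) < C := by
  have hg1 : g ≠ 1 := by
    rintro rfl
    exact hg 1 one_ne_zero (by simp)
  obtain ⟨S, hS⟩ := hH
  obtain ⟨D, hD⟩ : ∃ D : ℕ, ∀ x ∈ S, norm x ≤ D := ⟨S.sup norm, fun x hx => Finset.le_sup hx⟩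
  obtain ⟨E, hE, hEg⟩ := exists_gromov_pow_pow g
  obtain ⟨R, hR⟩ : ∃ R : ℕ, (D : ℤ) + norm g + E ≤ R :=
    ⟨((D : ℤ) + norm g + E).toNat, Int.self_le_toNat _⟩
  obtain ⟨B, hB⟩ : ∃ B : Finset (FreeGroup α), ∀ v, v ∈ B ↔ norm v ≤ R :=
    ⟨(finite_norm_le (α := α) R).toFinset, fun v => by simp⟩
  -- The exponents `0, …, I` outnumber the pairs of a side of the tripod and an element of `B`.
  obtain ⟨I, hI⟩ : ∃ I : ℕ, I = 2 * B.card := ⟨_, rfl⟩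
  obtain ⟨M, hMi⟩ : ∃ M : ℕ, ∀ i ≤ I, norm (g ^ i) ≤ M :=
    ⟨(Finset.range (I + 1)).sup fun i => norm (g ^ i), fun i hi =>
      Finset.le_sup (f := fun i => norm (g ^ i)) (Finset.mem_range.2 (by omega))⟩
  refine ⟨2 * M + 1, fun h hh hh1 j k => ?_⟩
  by_contra! hC
  have hIj : I ≤ j := by
    by_contra! hlt
    have h1 := gromov_le_left (g ^ j) (h * g ^ k)
    have h2 := hMi j hlt.le
    omega
  have hnear : ∀ i ≤ I, 2 * (norm (g ^ i) : ℤ) - 2 * E ≤ gromov (g ^ i) (h * g ^ k) := by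
    intro i hi
    have h1 := hEg i j (hi.trans hIj)
    have h2 := min_gromov_le (g ^ i) (g ^ j) (h * g ^ k)
    have h3 := hMi i hi
    omega
  have hdich : ∀ i : ℕ, ∃ v : Bool × FreeGroup α, i ≤ I → v.2 ∈ B ∧
      if v.1 then ∃ h' ∈ H, g ^ i = h' * v.2 else ∃ m : ℤ, g ^ i = h * g ^ m * v.2 := by
    intro i
    by_cases hi : i ≤ I
    swap
    · exact ⟨(true, 1), fun h => absurd h hi⟩
    -- In the tripod on `1`, `h`, `h * g ^ k`, the point `g ^ i` is near the side to `h` or near the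
    -- side from `h` to `h * g ^ k`; the second is treated with base point moved to `h`.
    by_cases hc : 2 * (norm (g ^ i) : ℤ) - 2 * E ≤ gromov (g ^ i) h
    · obtain ⟨h', hh', hn⟩ := exists_mem_norm_le_of_gromov (S := (S : Set (FreeGroup α)))
        (D := (D : ℤ)) (Int.natCast_nonneg _) (fun x hx => by exact_mod_cast hD x hx)
        (h := h) (by rw [hS]; exact hh) (g ^ i) hc
      rw [hS] at hh'
      refine ⟨(true, h'⁻¹ * g ^ i), fun _ => ⟨?_, ?_⟩⟩
      · refine (hB _).2 ?_
        dsimp only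
        omega
      · simp only [if_true]
        exact ⟨h', hh', by group⟩
    · have hn := hnear i hi
      have hmin := min_gromov_le (g ^ i) (h * g ^ k) h
      have hp : 2 * (norm (h⁻¹ * g ^ i) : ℤ) - 2 * E ≤ gromov (h⁻¹ * g ^ i) (g ^ k) := by
        have e1 : (h⁻¹ * g ^ i)⁻¹ * g ^ k = (g ^ i)⁻¹ * (h * g ^ k) := by group
        have e2 : (h * g ^ k)⁻¹ * h = (g ^ k)⁻¹ := by group
        have e3 := norm_inv_mul_comm h (g ^ i)
        unfold gromov at hn hmin hc ⊢
        rw [e2, norm_inv_eq] at hmin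
        rw [e1]
        omega
      obtain ⟨z, hz, hn⟩ := exists_mem_norm_le_of_gromov (S := {g})
        (D := (norm g : ℤ)) (Int.natCast_nonneg _) (fun x hx => by rw [Set.mem_singleton_iff.1 hx])
        (h := g ^ k) (zpow_mem (Subgroup.subset_closure (Set.mem_singleton g)) k) _ hp
      obtain ⟨m, rfl⟩ := Subgroup.mem_closure_singleton.1 hz
      refine ⟨(false, (g ^ m)⁻¹ * (h⁻¹ * g ^ i)), fun _ => ⟨?_, ?_⟩⟩
      · refine (hB _).2 ?_
        dsimp only
        omega
      · simp only [Bool.false_eq_true, if_false]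
        exact ⟨m, by group⟩
  choose f hf using hdich
  obtain ⟨i, hi, i', hi', hne, heq⟩ := Finset.exists_ne_map_eq_of_card_lt_of_maps_to
    (s := Finset.range (I + 1)) (t := Finset.univ ×ˢ B) (f := f)
    (by rw [Finset.card_product, Finset.card_range, Finset.card_univ, Fintype.card_bool]; omega)
    (fun i hi => Finset.mem_product.2 ⟨Finset.mem_univ _,
      (hf i (Nat.lt_succ_iff.1 (Finset.mem_range.1 hi))).1⟩)
  have h1 := (hf i (by have := Finset.mem_range.1 hi; omega)).2
  have h2 := (hf i' (by have := Finset.mem_range.1 hi'; omega)).2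
  have hne' : (i : ℤ) - i' ≠ 0 := by omega
  have hpow : g ^ ((i : ℤ) - i') = g ^ i * (g ^ i')⁻¹ := by
    rw [zpow_sub, zpow_natCast, zpow_natCast]
  rw [heq] at h1
  split_ifs at h1 h2
  · obtain ⟨a, ha, ha'⟩ := h1
    obtain ⟨b, hb, hb'⟩ := h2
    apply hg _ hne'
    rw [hpow, ha', hb', mul_inv_rev, mul_assoc, mul_inv_cancel_left]
    exact mul_mem ha (inv_mem hb)
  · obtain ⟨a, ha⟩ := h1
    obtain ⟨b, hb⟩ := h2
    have hconj : h * g ^ (a - b) * h⁻¹ = g ^ ((i : ℤ) - i') := by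
      rw [hpow, ha, hb, zpow_sub]; group
    have hab : a - b ≠ 0 := by
      intro h0
      rw [h0, zpow_zero, mul_one, mul_inv_cancel] at hconj
      exact hne' ((IsMulTorsionFree.zpow_eq_one_iff_right hg1).1 hconj.symm)
    obtain ⟨p, hp, hpH⟩ := exists_pow_mem_of_conj_zpow hg1 hh hh1 hab hconj
    exact hg p hp hpH

/-- A finitely generated subgroup with no nontrivial power of `g` moves the axis of `g` to
geodesics having uniformly bounded overlap with it. -/
theorem exists_gromov_zpow_lt [Finite α] {H : Subgroup (FreeGroup α)} (hH : H.FG)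
    {g : FreeGroup α} (hg : ∀ p : ℤ, p ≠ 0 → g ^ p ∉ H) :
    ∃ C : ℤ, 0 ≤ C ∧ ∀ h ∈ H, h ≠ 1 → ∀ j k : ℤ, gromov (g ^ j) (h * g ^ k) < C := by
  obtain ⟨C₁, h₁⟩ := exists_gromov_pow_lt hH hg
  obtain ⟨C₂, h₂⟩ := exists_gromov_pow_lt (g := g⁻¹) hH (fun p hp => by
    rw [inv_zpow']; exact hg _ (neg_ne_zero.2 hp))
  refine ⟨max 0 (max C₁ C₂), le_max_left _ _, fun h hh hh1 j k => ?_⟩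
  rcases Int.eq_nat_or_neg j with ⟨n, rfl | rfl⟩
  · have := h₁ h hh hh1 n k
    rw [zpow_natCast]
    omega
  · have := h₂ h hh hh1 n (-k)
    rw [inv_zpow', neg_neg, inv_pow] at this
    rw [zpow_neg, zpow_natCast]
    omega

end FreeGroup

end Overlap

/-! ### Length of alternating products in `H` and a power of `g` -/

section AlternatingProducts

/-- The product `t ^ k₁ * h₁ * t ^ k₂ * h₂ * ⋯` of a list of pairs `(kᵢ, hᵢ)`. -/
def altProd {G : Type*} [Group G] {H : Subgroup G} (t : G) : List (ℤ × H) → G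
  | [] => 1
  | p :: l => t ^ p.1 * p.2 * altProd t l

/-- All exponents are nonzero, and all group elements but the last are nontrivial. -/
def IsAlternating {G : Type*} [Group G] {H : Subgroup G} : List (ℤ × H) → Prop
  | [] => True
  | [p] => p.1 ≠ 0
  | p :: q :: l => p.1 ≠ 0 ∧ p.2 ≠ 1 ∧ IsAlternating (q :: l)

theorem IsAlternating.tail {G : Type*} [Group G] {H : Subgroup G} {p : ℤ × H}
    {l : List (ℤ × H)} (h : IsAlternating (p :: l)) : IsAlternating l := by
  cases l with
  | nil => trivial
  | cons q l => exact h.2.2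

theorem IsAlternating.fst_ne_zero {G : Type*} [Group G] {H : Subgroup G} {p : ℤ × H}
    {l : List (ℤ × H)} (h : IsAlternating (p :: l)) : p.1 ≠ 0 := by
  cases l with
  | nil => exact h
  | cons q l => exact h.1

theorem exists_zpow_mul_altProd {G : Type*} [Group G] {H : Subgroup G} (t : G) (k : ℤ) (h : H)
    {l : List (ℤ × H)} (hl : IsAlternating l) :
    ∃ (h' : H) (l' : List (ℤ × H)), IsAlternating l' ∧
      t ^ k * (h * altProd t l) = h' * altProd t l' := by
  by_cases hk : k = 0
  · exact ⟨h, l, hl, by simp [hk]⟩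
  cases l with
  | nil => exact ⟨1, [(k, h)], hk, by simp [altProd]⟩
  | cons q l =>
    by_cases hh : h = 1
    · by_cases hkq : k + q.1 = 0
      · refine ⟨q.2, l, hl.tail, ?_⟩
        simp only [altProd, hh, OneMemClass.coe_one, one_mul, ← mul_assoc, ← zpow_add, hkq,
          zpow_zero]
      · refine ⟨1, (k + q.1, q.2) :: l, ?_, ?_⟩
        · cases l with
          | nil => exact hkq
          | cons r l => exact ⟨hkq, hl.2.1, hl.2.2⟩
        · simp only [altProd, hh, OneMemClass.coe_one, one_mul, ← mul_assoc, ← zpow_add]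
    · exact ⟨1, (k, h) :: q :: l, ⟨hk, hh, hl⟩, by simp [altProd, mul_assoc]⟩

theorem exists_eq_mul_altProd {G : Type*} [Group G] {H : Subgroup G} (t : G) {x : G}
    (hx : x ∈ H ⊔ Subgroup.zpowers t) :
    ∃ (h : H) (l : List (ℤ × H)), IsAlternating l ∧ x = h * altProd t l := by
  rw [Subgroup.zpowers_eq_closure, ← Subgroup.closure_eq H, ← Subgroup.closure_union] at hx
  have step : ∀ a ∈ (H : Set G) ∪ {t}, ∀ e : ℤ, ∀ y : G,
      (∃ (h : H) (l : List (ℤ × H)), IsAlternating l ∧ y = h * altProd t l) →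
      ∃ (h : H) (l : List (ℤ × H)), IsAlternating l ∧ a ^ e * y = h * altProd t l := by
    rintro a (ha | rfl) e _ ⟨h, l, hl, rfl⟩
    · exact ⟨(⟨a, ha⟩ : H) ^ e * h, l, hl, by simp [mul_assoc]⟩
    · exact exists_zpow_mul_altProd _ e h hl
  induction hx using Subgroup.closure_induction_left with
  | one => exact ⟨1, [], trivial, by simp [altProd]⟩
  | mul_left a ha y hy ih => simpa using step a ha 1 y ih
  | inv_mul_cancel a ha y hy ih => simpa using step a ha (-1) y ih

variable {α : Type*} [DecidableEq α]

open FreeGroup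

/-- Each syllable loses at most `C` inside `t ^ k * h` and `C` at the junction with the next one.
The first conclusion carries the induction: the product follows its first power of `t` for at least
`C`, so by hyperbolicity the preceding syllable cancels less than `C` against it. The hypothesis
`hn` makes powers long enough to survive cancellation at both ends. -/
theorem gromov_altProd {H : Subgroup (FreeGroup α)} {g : FreeGroup α} {C : ℤ} (hC0 : 0 ≤ C)
    (hC : ∀ h ∈ H, h ≠ 1 → ∀ j k : ℤ, gromov (g ^ j) (h * g ^ k) < C) {n : ℕ}
    (hn : ∀ k : ℤ, k ≠ 0 → 3 * C ≤ 2 * FreeGroup.norm ((g ^ n) ^ k)) (p : ℤ × H) (l : List (ℤ × H))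
    (hl : IsAlternating (p :: l)) :
    C ≤ gromov (altProd (g ^ n) (p :: l)) ((g ^ n) ^ p.1) ∧
    ((p :: l).map fun q => (FreeGroup.norm ((g ^ n) ^ q.1) + FreeGroup.norm (q.2 : FreeGroup α) - 2 * C : ℤ)).sum ≤
      FreeGroup.norm (altProd (g ^ n) (p :: l)) := by
  have hconj : ∀ k : ℤ, (g ^ n) ^ k = g ^ (n * k : ℤ) := fun k => by
    rw [zpow_mul, zpow_natCast]
  have hblock : ∀ (k : ℤ) (h : H),
      (FreeGroup.norm ((g ^ n) ^ k) + FreeGroup.norm (h : FreeGroup α) - C : ℤ) ≤ FreeGroup.norm ((g ^ n) ^ k * (h : FreeGroup α)) := by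
    intro k h
    by_cases hh : h = 1
    · simp [hh, hC0]
    · have := hC h h.2 (by simpa using hh) (-(n * k)) 0
      rw [zpow_zero, mul_one, gromov, zpow_neg, ← hconj, inv_inv, norm_inv_eq] at this
      omega
  induction l generalizing p with
  | nil =>
    have h1 := hblock p.1 p.2
    have h2 := hn p.1 hl
    simp only [altProd, mul_one, List.map_cons, List.map_nil, List.sum_cons, List.sum_nil]
    refine ⟨?_, by omega⟩
    rw [gromov_comm, gromov]
    rw [inv_mul_cancel_left]
    omega
  | cons q l ih =>
    obtain ⟨ih1, ih2⟩ := ih q hl.tail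
    have h1 := hblock p.1 p.2
    have h2 := hn p.1 hl.1
    have h3 : gromov ((g ^ n) ^ q.1) ((p.2 : FreeGroup α)⁻¹ * ((g ^ n) ^ p.1)⁻¹) < C := by
      rw [hconj, hconj, ← zpow_neg]
      exact hC _ (inv_mem p.2.2) (by simpa using hl.2.1) _ _
    have h4 := min_gromov_le ((g ^ n) ^ q.1) (altProd (g ^ n) (q :: l))
      ((p.2 : FreeGroup α)⁻¹ * ((g ^ n) ^ p.1)⁻¹)
    rw [gromov_comm] at h4
    have h5 : gromov (altProd (g ^ n) (q :: l)) ((p.2 : FreeGroup α)⁻¹ * ((g ^ n) ^ p.1)⁻¹) < C := by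
      rcases min_le_iff.1 h4 with h | h <;> omega
    have h6 : FreeGroup.norm ((p.2 : FreeGroup α)⁻¹ * ((g ^ n) ^ p.1)⁻¹) = FreeGroup.norm ((g ^ n) ^ p.1 * (p.2 : FreeGroup α)) := by
      rw [← norm_inv_eq]; congr 1; group
    have h7 : altProd (g ^ n) (p :: q :: l) =
        ((p.2 : FreeGroup α)⁻¹ * ((g ^ n) ^ p.1)⁻¹)⁻¹ * altProd (g ^ n) (q :: l) := by
      rw [altProd]; group
    have h8 : ((g ^ n) ^ p.1)⁻¹ * altProd (g ^ n) (p :: q :: l) =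
        p.2 * altProd (g ^ n) (q :: l) := by
      rw [altProd]; group
    have h9 := norm_mul_le (p.2 : FreeGroup α) (altProd (g ^ n) (q :: l))
    rw [gromov_comm, gromov, ← h7, h6] at h5
    rw [gromov_comm _ ((g ^ n) ^ p.1), gromov, h8, List.map_cons, List.sum_cons]
    omega

/-- The leading `h` costs one further `C`; charging `3 * C` to every syllable covers it and keeps
the bound multiplicative. -/
theorem norm_mul_altProd {H : Subgroup (FreeGroup α)} {g : FreeGroup α} {C : ℤ} (hC0 : 0 ≤ C)
    (hC : ∀ h ∈ H, h ≠ 1 → ∀ j k : ℤ, gromov (g ^ j) (h * g ^ k) < C) {n : ℕ}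
    (hn : ∀ k : ℤ, k ≠ 0 → 3 * C ≤ 2 * FreeGroup.norm ((g ^ n) ^ k)) (h : H) (l : List (ℤ × H))
    (hl : IsAlternating l) :
    FreeGroup.norm (h : FreeGroup α) +
      (l.map fun q => (FreeGroup.norm ((g ^ n) ^ q.1) + FreeGroup.norm (q.2 : FreeGroup α) - 3 * C : ℤ)).sum ≤
      FreeGroup.norm ((h : FreeGroup α) * altProd (g ^ n) l) := by
  cases l with
  | nil => simp [altProd]
  | cons p l =>
    obtain ⟨h1, h2⟩ := gromov_altProd hC0 hC hn p l hl
    have h3 : ∀ l : List (ℤ × H),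
        (l.map fun q => (FreeGroup.norm ((g ^ n) ^ q.1) + FreeGroup.norm (q.2 : FreeGroup α) - 3 * C : ℤ)).sum ≤
        (l.map fun q => (FreeGroup.norm ((g ^ n) ^ q.1) + FreeGroup.norm (q.2 : FreeGroup α) - 2 * C : ℤ)).sum :=
      fun l => List.sum_le_sum fun q _ => by omega
    by_cases hh : h = 1
    · simpa [hh] using (h3 (p :: l)).trans h2
    · have h4 : gromov ((g ^ n) ^ p.1) ((h : FreeGroup α)⁻¹) < C := by
        have := hC _ (inv_mem h.2) (by simpa using hh) (n * p.1) 0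
        rwa [zpow_zero, mul_one, zpow_mul, zpow_natCast] at this
      have h5 := min_gromov_le ((g ^ n) ^ p.1) (altProd (g ^ n) (p :: l)) ((h : FreeGroup α)⁻¹)
      rw [gromov_comm] at h5
      have h6 : gromov (altProd (g ^ n) (p :: l)) ((h : FreeGroup α)⁻¹) < C := by
        rcases min_le_iff.1 h5 with h | h <;> omega
      rw [gromov_comm, gromov, norm_inv_eq, inv_inv] at h6
      have h7 := h3 l
      rw [List.map_cons, List.sum_cons] at h2 ⊢
      omega

end AlternatingProducts

/-! ### Poincaré series after adjoining a power -/

section PoincareSeries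

variable {α : Type*} [DecidableEq α]

open FreeGroup

theorem ENNReal.tsum_fin_prod {β : Type*} (w : β → ℝ≥0∞) (m : ℕ) :
    ∑' f : Fin m → β, ∏ i, w (f i) = (∑' b, w b) ^ m := by
  induction m with
  | zero => simp
  | succ m ih =>
    rw [← (Fin.consEquiv fun _ => β).tsum_eq, ENNReal.tsum_prod', pow_succ', ← ih,
      ← ENNReal.tsum_mul_right]
    refine tsum_congr fun b => ?_
    rw [← ENNReal.tsum_mul_left]
    refine tsum_congr fun f => ?_
    simp [Fin.prod_univ_succ]

theorem ENNReal.tsum_list_prod {β : Type*} (w : β → ℝ≥0∞) :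
    ∑' l : List β, (l.map w).prod = (1 - ∑' b, w b)⁻¹ := by
  rw [← List.equivSigmaTuple.symm.tsum_eq, ENNReal.tsum_sigma', ← ENNReal.tsum_geometric]
  refine tsum_congr fun m => ?_
  rw [← ENNReal.tsum_fin_prod]
  refine tsum_congr fun f => ?_
  simp [List.equivSigmaTuple, List.prod_ofFn]

/-- The Poincaré series of a subgroup of a free group, with values in `[0, ∞]`. -/
noncomputable def poincareSeries (s : ℝ) (H : Subgroup (FreeGroup α)) : ℝ≥0∞ :=
  ∑' h : H, ENNReal.ofReal (Real.exp (-s * FreeGroup.norm (h : FreeGroup α)))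

theorem exp_list_sum {β : Type*} (s : ℝ) (f : β → ℤ) (l : List β) :
    ENNReal.ofReal (Real.exp (-s * ((l.map f).sum : ℤ))) =
      (l.map fun b => ENNReal.ofReal (Real.exp (-s * (f b : ℤ)))).prod := by
  induction l with
  | nil => simp
  | cons b l ih =>
    rw [List.map_cons, List.map_cons, List.sum_cons, List.prod_cons, ← ih,
      ← ENNReal.ofReal_mul (Real.exp_pos _).le, ← Real.exp_add]
    push_cast
    ring_nf

theorem poincareSeries_sup_zpowers_le {s : ℝ} (hs : 0 < s) {H : Subgroup (FreeGroup α)}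
    {g : FreeGroup α} {C : ℤ} (hC0 : 0 ≤ C)
    (hC : ∀ h ∈ H, h ≠ 1 → ∀ j k : ℤ, gromov (g ^ j) (h * g ^ k) < C) {n : ℕ}
    (hn : ∀ k : ℤ, k ≠ 0 → 3 * C ≤ 2 * FreeGroup.norm ((g ^ n) ^ k)) :
    poincareSeries s (H ⊔ Subgroup.zpowers (g ^ n)) ≤ poincareSeries s H *
      (1 - (∑' k : ℤ, if k = 0 then 0 else
        ENNReal.ofReal (Real.exp (-s * (FreeGroup.norm ((g ^ n) ^ k) - 3 * C)))) * poincareSeries s H)⁻¹ := by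
  classical
  set a : ℤ → ℝ≥0∞ := fun k => if k = 0 then 0 else
    ENNReal.ofReal (Real.exp (-s * (FreeGroup.norm ((g ^ n) ^ k) - 3 * C))) with ha
  set φ : H → ℝ≥0∞ := fun h => ENNReal.ofReal (Real.exp (-s * FreeGroup.norm (h : FreeGroup α))) with hφ
  have hw : (∑' p : ℤ × H, a p.1 * φ p.2) = (∑' k, a k) * poincareSeries s H := by
    rw [ENNReal.tsum_prod', poincareSeries, ← ENNReal.tsum_mul_right]
    exact tsum_congr fun k => by simp only [hφ]; exact ENNReal.tsum_mul_left
  have hrhs : poincareSeries s H * (1 - (∑' k, a k) * poincareSeries s H)⁻¹ =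
      ∑' x : H × List (ℤ × H), φ x.1 * (x.2.map fun p => a p.1 * φ p.2).prod := by
    rw [← hw, ← ENNReal.tsum_list_prod, ENNReal.tsum_prod', poincareSeries,
      ← ENNReal.tsum_mul_right]
    exact tsum_congr fun k => ENNReal.tsum_mul_left.symm
  rw [hrhs]
  choose h l hl hx using fun x : (H ⊔ Subgroup.zpowers (g ^ n) : Subgroup (FreeGroup α)) =>
    exists_eq_mul_altProd (g ^ n) x.2
  -- Only an upper bound is needed, so one chosen expression per element suffices; uniqueness of
  -- normal forms plays no role.
  have hinj : Function.Injective fun x => (h x, l x) := by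
    intro x y hxy
    simp only [Prod.mk.injEq] at hxy
    apply Subtype.ext
    rw [hx x, hx y, hxy.1, hxy.2]
  refine le_trans ?_ (ENNReal.tsum_comp_le_tsum_of_injective hinj _)
  refine ENNReal.tsum_le_tsum fun x => ?_
  have hlen := norm_mul_altProd hC0 hC hn (h x) (l x) (hl x)
  rw [← hx x] at hlen
  have hprod : ∀ l : List (ℤ × H), IsAlternating l →
      (l.map fun p => a p.1 * φ p.2).prod = ENNReal.ofReal (Real.exp (-s *
        ((l.map fun q => (FreeGroup.norm ((g ^ n) ^ q.1) + FreeGroup.norm (q.2 : FreeGroup α) - 3 * C : ℤ)).sum : ℤ))) := by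
    intro l
    rw [exp_list_sum]
    induction l with
    | nil => simp
    | cons p l ih =>
      intro hl
      rw [List.map_cons, List.map_cons, List.prod_cons, List.prod_cons, ih hl.tail]
      congr 1
      simp only [ha, hφ, if_neg hl.fst_ne_zero]
      rw [← ENNReal.ofReal_mul (Real.exp_pos _).le, ← Real.exp_add]
      push_cast
      ring_nf
  rw [hprod _ (hl x), hφ, ← ENNReal.ofReal_mul (Real.exp_pos _).le, ← Real.exp_add]
  apply ENNReal.ofReal_le_ofReal
  apply Real.exp_le_exp.2
  have : (FreeGroup.norm (h x : FreeGroup α) : ℝ) + (((l x).map fun q =>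
      (FreeGroup.norm ((g ^ n) ^ q.1) + FreeGroup.norm (q.2 : FreeGroup α) - 3 * C : ℤ)).sum : ℤ) ≤
      FreeGroup.norm (x : FreeGroup α) := by exact_mod_cast hlen
  nlinarith

theorem summable_exp_neg_mul_natAbs {s : ℝ} (hs : 0 < s) :
    Summable fun k : ℤ => Real.exp (-s * k.natAbs) := by
  have : Summable fun n : ℕ => Real.exp (-s * n) := by
    have := summable_geometric_of_lt_one (Real.exp_pos (-s)).le (Real.exp_lt_one_iff.2 (by linarith))
    refine this.congr fun n => ?_
    rw [← Real.exp_nat_mul, mul_comm]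
  exact Summable.of_nat_of_neg (by simpa using this) (by simpa using this)

/-- Adding a large power of `g` to a finitely generated subgroup which contains no nontrivial
power of `g` increases the Poincaré series by an arbitrarily small amount. -/
theorem exists_poincareSeries_sup_zpowers_lt [Finite α] {s : ℝ} (hs : 0 < s)
    {H : Subgroup (FreeGroup α)} (hH : H.FG) {g : FreeGroup α}
    (hg : ∀ p : ℤ, p ≠ 0 → g ^ p ∉ H) {B : ℝ≥0∞} (hB : poincareSeries s H < B) :
    ∃ n : ℕ, 1 ≤ n ∧ poincareSeries s (H ⊔ Subgroup.zpowers (g ^ n)) < B := by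
  have hg1 : g ≠ 1 := by
    rintro rfl
    exact hg 1 one_ne_zero (by simp)
  have hP : poincareSeries s H ≠ ∞ := (hB.trans_le le_top).ne
  obtain ⟨C, hC0, hC⟩ := exists_gromov_zpow_lt hH hg
  set K : ℝ≥0∞ := ∑' k : ℤ, ENNReal.ofReal (Real.exp (-s * k.natAbs)) with hK
  have hKtop : K ≠ ∞ := (summable_exp_neg_mul_natAbs hs).tsum_ofReal_ne_top
  set q : ℕ → ℝ≥0∞ := fun n => ∑' k : ℤ, if k = 0 then 0 else
        ENNReal.ofReal (Real.exp (-s * (FreeGroup.norm ((g ^ n) ^ k) - 3 * C))) with hq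
  have hnorm : ∀ (n : ℕ) (k : ℤ), n * k.natAbs ≤ FreeGroup.norm ((g ^ n) ^ k) := by
    intro n k
    have := natAbs_le_norm_zpow hg1 (n * k : ℤ)
    rwa [Int.natAbs_mul, Int.natAbs_natCast, zpow_mul, zpow_natCast] at this
  have hqle : ∀ n : ℕ, 1 ≤ n →
      q n ≤ ENNReal.ofReal (Real.exp (s * (3 * C + 1)) * Real.exp (-s) ^ n) * K := by
    intro n hn
    rw [hq, hK, ← ENNReal.tsum_mul_left]
    refine ENNReal.tsum_le_tsum fun k => ?_
    split_ifs with hk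
    · exact zero_le
    · rw [← ENNReal.ofReal_mul (by positivity), ← Real.exp_nat_mul, ← Real.exp_add, ← Real.exp_add]
      apply ENNReal.ofReal_le_ofReal
      apply Real.exp_le_exp.2
      have h1 : ((n : ℝ) * k.natAbs) ≤ FreeGroup.norm ((g ^ n) ^ k) := by exact_mod_cast hnorm n k
      have h2 : (1 : ℝ) ≤ k.natAbs := by
        have : 1 ≤ k.natAbs := by omega
        exact_mod_cast this
      have h3 : (1 : ℝ) ≤ n := by exact_mod_cast hn
      -- Replacing `n * |k|` by `n + |k| - 1` separates the decay in `n` from the summation over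
      -- `k`; the `1` accounts for `3 * C + 1`.
      have h4 : (n : ℝ) + k.natAbs - 1 ≤ FreeGroup.norm ((g ^ n) ^ k) := by nlinarith
      nlinarith
  have hq0 : Tendsto q atTop (𝓝 0) := by
    have h1 : Tendsto (fun n : ℕ =>
        ENNReal.ofReal (Real.exp (s * (3 * C + 1)) * Real.exp (-s) ^ n) * K) atTop (𝓝 0) := by
      have h2 : Tendsto (fun n : ℕ => Real.exp (s * (3 * C + 1)) * Real.exp (-s) ^ n) atTop
          (𝓝 0) := by
        simpa using (tendsto_pow_atTop_nhds_zero_of_lt_one (Real.exp_pos (-s)).le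
          (Real.exp_lt_one_iff.2 (by linarith))).const_mul (Real.exp (s * (3 * C + 1)))
      have h3 := ENNReal.Tendsto.mul_const (b := K) (ENNReal.tendsto_ofReal h2) (Or.inr hKtop)
      simpa using h3
    refine tendsto_of_tendsto_of_tendsto_of_le_of_le' tendsto_const_nhds h1
      (Eventually.of_forall fun _ => zero_le) ?_
    filter_upwards [eventually_ge_atTop 1] with n hn using hqle n hn
  have hlim : Tendsto (fun n => poincareSeries s H * (1 - q n * poincareSeries s H)⁻¹) atTop
      (𝓝 (poincareSeries s H)) := by
    have h1 := ENNReal.Tendsto.mul_const hq0 (Or.inr hP)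
    have h2 := ENNReal.Tendsto.sub (tendsto_const_nhds (x := (1 : ℝ≥0∞))) h1 (Or.inl (by simp))
    have h3 := tendsto_inv_iff.2 h2
    have h4 := ENNReal.Tendsto.const_mul (a := poincareSeries s H) h3 (Or.inr hP)
    simpa using h4
  obtain ⟨n, hn1, hn2, hn3⟩ := ((eventually_ge_atTop 1).and ((eventually_ge_atTop (3 * C).toNat).and
    (hlim.eventually (gt_mem_nhds hB)))).exists
  refine ⟨n, hn1, lt_of_le_of_lt (poincareSeries_sup_zpowers_le hs hC0 hC fun k hk => ?_) hn3⟩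
  have h1 := hnorm n k
  have h2 : 1 ≤ k.natAbs := by omega
  have h3 : n ≤ FreeGroup.norm ((g ^ n) ^ k) := by nlinarith
  omega

end PoincareSeries

/-! ### Boomerang subgroups containing a given finitely generated subgroup -/

section Boomerang

/-- A subgroup containing a positive power of every element is a boomerang subgroup. -/
theorem isBoomerang_of_forall_exists_pow_mem {G : Type*} [Group G] {H : Subgroup G}
    (h : ∀ g : G, ∃ n : ℕ, 1 ≤ n ∧ g ^ n ∈ H) : IsBoomerang H := by
  intro g
  obtain ⟨n, hn, hgn⟩ := h g
  refine ⟨fun k => n * k, tendsto_id.const_mul_atTop' (by omega), ?_⟩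
  have hconj : ∀ k : ℕ, conjSubgroup (g ^ (n * k)) H = H := fun k =>
    Subgroup.conj_smul_eq_self_of_mem (by rw [pow_mul]; exact pow_mem hgn k)
  simp only [hconj]
  exact tendsto_const_nhds

variable {α : Type*} [DecidableEq α]

open FreeGroup

theorem poincareSeries_eq_tsum_indicator (s : ℝ) (H : Subgroup (FreeGroup α)) :
    poincareSeries s H = ∑' x : FreeGroup α, (H : Set (FreeGroup α)).indicator
      (fun x => ENNReal.ofReal (Real.exp (-s * FreeGroup.norm x))) x :=
  tsum_subtype (H : Set (FreeGroup α)) fun x => ENNReal.ofReal (Real.exp (-s * FreeGroup.norm x))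

theorem poincareSeries_mono (s : ℝ) {H K : Subgroup (FreeGroup α)} (h : H ≤ K) :
    poincareSeries s H ≤ poincareSeries s K := by
  rw [poincareSeries_eq_tsum_indicator, poincareSeries_eq_tsum_indicator]
  exact ENNReal.tsum_le_tsum fun x =>
    Set.indicator_le_indicator_of_subset h (fun _ => zero_le) x

theorem poincareSeries_iSup_le {s : ℝ} {K : ℕ → Subgroup (FreeGroup α)} (hK : Monotone K)
    {B : ℝ≥0∞} (hB : ∀ i, poincareSeries s (K i) ≤ B) : poincareSeries s (⨆ i, K i) ≤ B := by
  classical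
  rw [poincareSeries_eq_tsum_indicator, ENNReal.tsum_eq_iSup_sum]
  refine iSup_le fun t => ?_
  have hi : ∀ x : FreeGroup α, ∃ i, x ∈ ⨆ i, K i → x ∈ K i := by
    intro x
    by_cases hx : x ∈ ⨆ i, K i
    · obtain ⟨i, hi⟩ := (Subgroup.mem_iSup_of_directed hK.directed_le).1 hx
      exact ⟨i, fun _ => hi⟩
    · exact ⟨0, fun h => absurd h hx⟩
  choose i hi using hi
  refine le_trans ?_ (hB (t.sup i))
  rw [poincareSeries_eq_tsum_indicator]
  refine le_trans (Finset.sum_le_sum fun x hx => ?_) (ENNReal.sum_le_tsum t)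
  by_cases hxK : x ∈ ⨆ i, K i
  · have : x ∈ K (t.sup i) := hK (Finset.le_sup hx) (hi x hxK)
    rw [Set.indicator_of_mem hxK, Set.indicator_of_mem this]
  · rw [Set.indicator_of_notMem hxK]
    exact zero_le

/-- A finitely generated subgroup is contained in a boomerang subgroup whose Poincaré series
still converges. -/
theorem exists_isBoomerang_poincareSeries_ne_top [Finite α] {s : ℝ} (hs : 0 < s)
    {H : Subgroup (FreeGroup α)} (hH : H.FG) (hP : poincareSeries s H ≠ ∞) :
    ∃ K : Subgroup (FreeGroup α), IsBoomerang K ∧ H ≤ K ∧ poincareSeries s K ≠ ∞ := by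
  -- A fixed budget: the strict bound by `B` always leaves room for the next power.
  set B := poincareSeries s H + 1
  have hB : B ≠ ∞ := ENNReal.add_ne_top.2 ⟨hP, ENNReal.one_ne_top⟩
  have step : ∀ (K : {K : Subgroup (FreeGroup α) // K.FG ∧ poincareSeries s K < B})
      (g : FreeGroup α), ∃ K' : {K : Subgroup (FreeGroup α) // K.FG ∧ poincareSeries s K < B},
        K.1 ≤ K'.1 ∧ ∃ n : ℕ, 1 ≤ n ∧ g ^ n ∈ K'.1 := by
    rintro ⟨K, hK, hKB⟩ g
    by_cases hg : ∀ p : ℤ, p ≠ 0 → g ^ p ∉ K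
    · obtain ⟨n, hn, hlt⟩ := exists_poincareSeries_sup_zpowers_lt hs hK hg hKB
      have hfg : (Subgroup.zpowers (g ^ n)).FG := ⟨{g ^ n}, by
        rw [Finset.coe_singleton, Subgroup.zpowers_eq_closure]⟩
      exact ⟨⟨_, hK.sup hfg, hlt⟩, le_sup_left, n, hn,
        Subgroup.mem_sup_right (Subgroup.mem_zpowers _)⟩
    · push Not at hg
      obtain ⟨p, hp, hpK⟩ := hg
      refine ⟨⟨K, hK, hKB⟩, le_rfl, p.natAbs, by omega, ?_⟩
      rcases Int.natAbs_eq p with h | h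
      · rwa [h, zpow_natCast] at hpK
      · rw [h, zpow_neg, zpow_natCast] at hpK
        simpa using inv_mem hpK
  choose next hnext n hn hpow using step
  have hcount : Countable (FreeGroup α) := (toWord_injective (α := α)).countable
  obtain ⟨e, he⟩ := exists_surjective_nat (FreeGroup α)
  let K : ℕ → {K : Subgroup (FreeGroup α) // K.FG ∧ poincareSeries s K < B} := fun i =>
    Nat.rec ⟨H, hH, ENNReal.lt_add_right hP one_ne_zero⟩ (fun i K => next K (e i)) i
  have hmono : Monotone fun i => (K i).1 := monotone_nat_of_le_succ fun i => hnext (K i) (e i)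
  refine ⟨⨆ i, (K i).1, isBoomerang_of_forall_exists_pow_mem fun g => ?_,
    le_iSup (fun i => (K i).1) 0,
    ((poincareSeries_iSup_le hmono fun i => (K i).2.2.le).trans_lt hB.lt_top).ne⟩
  obtain ⟨i, rfl⟩ := he g
  exact ⟨n (K i) (e i), hn _ _, (le_iSup (fun i => (K i).1) (i + 1)) (hpow (K i) (e i))⟩

end Boomerang

/-! ### Convergence of the Poincaré series of the free group -/

section Growth

variable {α : Type*} [DecidableEq α]

open FreeGroup

theorem norm_mk_singleton_mul (a : α × Bool) (x : FreeGroup α) :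
    (FreeGroup.norm (mk [a] * x) : ℤ) =
      if x.toWord.head? = some (a.1, !a.2) then (FreeGroup.norm x : ℤ) - 1
      else FreeGroup.norm x + 1 := by
  have h1 : (mk [a] * x).toWord = reduce (a :: x.toWord) := by
    conv_lhs => rw [← mk_toWord (x := x), mul_mk, toWord_mk, List.singleton_append]
  rw [FreeGroup.norm, h1, reduce.cons, reduce_toWord, FreeGroup.norm]
  cases hx : x.toWord with
  | nil => simp
  | cons b l =>
    by_cases hab : b = (a.1, !a.2)
    · simp [hab]
    · have : ¬ (a.1 = b.1 ∧ a.2 = !b.2) := by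
        rintro ⟨h1, h2⟩
        apply hab
        ext <;> simp [h1, h2]
      simp [hab, this]

theorem exists_eq_mk_singleton_mul {x : FreeGroup α} (hx : x ≠ 1) :
    ∃ (a : α × Bool) (y : FreeGroup α), x = mk [a] * y ∧
      y.toWord.head? ≠ some (a.1, !a.2) ∧ FreeGroup.norm x = FreeGroup.norm y + 1 := by
  cases h : x.toWord with
  | nil => exact absurd (toWord_eq_nil_iff.1 h) hx
  | cons a l =>
    have hxl : x = mk [a] * mk l := by
      rw [mul_mk, List.singleton_append, ← h, mk_toWord]
    have hl : IsReduced l := by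
      have := isReduced_toWord (x := x)
      rw [h] at this
      exact this.infix (List.suffix_cons a l).isInfix
    have hn : FreeGroup.norm x = FreeGroup.norm (mk l) + 1 := by
      rw [FreeGroup.norm, FreeGroup.norm, h, toWord_mk, hl.reduce_eq, List.length_cons]
    refine ⟨a, mk l, hxl, fun hhead => ?_, hn⟩
    have := norm_mk_singleton_mul a (mk l)
    rw [← hxl, if_pos hhead] at this
    omega

theorem sum_letter_ite [Fintype α] {x : FreeGroup α} (hx : x ≠ 1) (u v : ℝ) :
    ∑ a : α × Bool, (if x.toWord.head? = some (a.1, !a.2) then u else v) =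
      u + (2 * Fintype.card α - 1) * v := by
  cases h : x.toWord with
  | nil => exact absurd (toWord_eq_nil_iff.1 h) hx
  | cons b l =>
    have hiff : ∀ a : α × Bool, ((b :: l).head? = some (a.1, !a.2)) ↔ a = (b.1, !b.2) := by
      intro a
      rw [List.head?_cons, Option.some_inj]
      constructor
      · rintro rfl; simp
      · rintro rfl; simp
    simp only [hiff]
    rw [← Finset.add_sum_erase _ _ (Finset.mem_univ (b.1, !b.2)), if_pos rfl]
    congr 1
    rw [Finset.sum_congr rfl fun a ha => if_neg (Finset.ne_of_mem_erase ha), Finset.sum_const,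
      Finset.card_erase_of_mem (Finset.mem_univ _), Finset.card_univ, Fintype.card_prod,
      Fintype.card_bool, nsmul_eq_mul]
    have : 1 ≤ Fintype.card α * 2 := by
      have : 0 < Fintype.card α := Fintype.card_pos_iff.2 ⟨b.1⟩
      omega
    rw [Nat.cast_sub this]
    push_cast
    ring

/-- Each nontrivial word extends on the left by `q = 2 * card α - 1` letters, so sums over balls
satisfy `S (n + 1) ≤ c + r * S n` with `r = q * exp (-s) < 1`. They stay below the fixed point `c /
(1 - r)`; the constant `c` accounts for the identity. -/
theorem summable_exp_neg_mul_norm [Fintype α] [Nonempty α] {s : ℝ}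
    (hs : Real.log (2 * Fintype.card α - 1) < s) :
    Summable fun x : FreeGroup α => Real.exp (-s * FreeGroup.norm x) := by
  classical
  have hcard : (1 : ℝ) ≤ Fintype.card α := by exact_mod_cast Fintype.card_pos
  set q : ℝ := 2 * Fintype.card α - 1 with hq
  have hq1 : 1 ≤ q := by linarith
  have hr : q * Real.exp (-s) < 1 := by
    have := (Real.log_lt_iff_lt_exp (by linarith)).1 hs
    rw [Real.exp_neg, ← div_eq_mul_inv, div_lt_one (Real.exp_pos _)]
    exact this
  set r := q * Real.exp (-s)
  have hr0 : 0 < r := by positivity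
  obtain ⟨ball, hball⟩ : ∃ ball : ℕ → Finset (FreeGroup α),
      ∀ n x, x ∈ ball n ↔ FreeGroup.norm x ≤ n :=
    ⟨fun n => (finite_norm_le (α := α) n).toFinset, fun n x => by simp⟩
  set f : FreeGroup α → ℝ := fun x => Real.exp (-s * FreeGroup.norm x) with hf
  set c : ℝ := 1 + ∑ a : α × Bool, Real.exp (-s) with hc
  have hc0 : 0 ≤ c := by positivity
  have hstep : ∀ n, ∑ x ∈ ball (n + 1), f x ≤ c + r * ∑ x ∈ ball n, f x := by
    intro n
    have hsub : ball (n + 1) ⊆ {1} ∪ ((Finset.univ ×ˢ ball n).filter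
        fun p : (α × Bool) × FreeGroup α => p.2.toWord.head? ≠ some (p.1.1, !p.1.2)).image
          fun p => mk [p.1] * p.2 := by
      intro x hx
      rw [Finset.mem_union, Finset.mem_singleton]
      by_cases hx1 : x = 1
      · exact Or.inl hx1
      · obtain ⟨a, y, rfl, hay, hn⟩ := exists_eq_mk_singleton_mul hx1
        refine Or.inr (Finset.mem_image.2 ⟨(a, y), Finset.mem_filter.2 ⟨Finset.mem_product.2
          ⟨Finset.mem_univ _, (hball _ _).2 ?_⟩, hay⟩, rfl⟩)
        have := (hball _ _).1 hx
        dsimp only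
        omega
    have hf0 : ∀ x, 0 ≤ f x := fun x => (Real.exp_pos _).le
    have hinner : ∀ y, ∑ a : α × Bool, (if y.toWord.head? = some (a.1, !a.2) then 0
        else Real.exp (-s) * f y) ≤ (if y = 1 then ∑ a : α × Bool, Real.exp (-s) else 0) + r * f y := by
      intro y
      by_cases hy : y = 1
      · have : 0 ≤ r * f y := by positivity
        simp only [hy, toWord_one, List.head?_nil, reduceCtorEq, if_false, if_true] at this ⊢
        have hf1 : f 1 = 1 := by simp [hf]
        rw [hf1, mul_one] at *
        linarith
      · rw [sum_letter_ite hy, if_neg hy]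
        exact le_of_eq (by ring)
    calc ∑ x ∈ ball (n + 1), f x
        ≤ ∑ x ∈ {1} ∪ ((Finset.univ ×ˢ ball n).filter
          fun p : (α × Bool) × FreeGroup α => p.2.toWord.head? ≠ some (p.1.1, !p.1.2)).image
          (fun p => mk [p.1] * p.2), f x :=
          Finset.sum_le_sum_of_subset_of_nonneg hsub fun x _ _ => hf0 x
      _ ≤ 1 + ∑ x ∈ ((Finset.univ ×ˢ ball n).filter
          fun p : (α × Bool) × FreeGroup α => p.2.toWord.head? ≠ some (p.1.1, !p.1.2)).image
          (fun p => mk [p.1] * p.2), f x := by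
          have h1 := Finset.sum_union_inter (s₁ := {1}) (s₂ := ((Finset.univ ×ˢ ball n).filter
            fun p : (α × Bool) × FreeGroup α => p.2.toWord.head? ≠ some (p.1.1, !p.1.2)).image
            (fun p => mk [p.1] * p.2)) (f := f)
          have h2 : ∑ x ∈ ({1} : Finset (FreeGroup α)), f x = 1 := by simp [hf]
          have h3 := Finset.sum_nonneg (s := {1} ∩ ((Finset.univ ×ˢ ball n).filter
            fun p : (α × Bool) × FreeGroup α => p.2.toWord.head? ≠ some (p.1.1, !p.1.2)).image
            (fun p => mk [p.1] * p.2)) fun x _ => hf0 x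
          linarith
      _ ≤ 1 + ∑ p ∈ (Finset.univ ×ˢ ball n).filter
          (fun p : (α × Bool) × FreeGroup α => p.2.toWord.head? ≠ some (p.1.1, !p.1.2)),
          f (mk [p.1] * p.2) := by
          gcongr
          exact Finset.sum_image_le_of_nonneg fun x _ => hf0 _
      _ = 1 + ∑ p ∈ (Finset.univ : Finset (α × Bool)) ×ˢ ball n,
          (if p.2.toWord.head? = some (p.1.1, !p.1.2) then 0 else Real.exp (-s) * f p.2) := by
          rw [Finset.sum_filter]
          congr 1
          refine Finset.sum_congr rfl fun p _ => ?_
          by_cases hp : p.2.toWord.head? = some (p.1.1, !p.1.2)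
          · simp [hp]
          · have := norm_mk_singleton_mul p.1 p.2
            rw [if_neg hp] at this
            have h' : (FreeGroup.norm (mk [p.1] * p.2) : ℝ) = FreeGroup.norm p.2 + 1 := by
              exact_mod_cast this
            rw [if_pos hp, if_neg hp]
            simp only [hf]
            rw [h', ← Real.exp_add]
            ring_nf
      _ = 1 + ∑ y ∈ ball n, ∑ a : α × Bool,
          (if y.toWord.head? = some (a.1, !a.2) then 0 else Real.exp (-s) * f y) := by
          rw [Finset.sum_product_right]
      _ ≤ 1 + ∑ y ∈ ball n, ((if y = 1 then ∑ a : α × Bool, Real.exp (-s) else 0) + r * f y) := by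
          gcongr with y _
          exact hinner y
      _ = c + r * ∑ x ∈ ball n, f x := by
          rw [Finset.sum_add_distrib, ← Finset.mul_sum, Finset.sum_ite_eq',
            if_pos ((hball _ _).2 (by simp)), hc, add_assoc]
  have hbound : ∀ n, ∑ x ∈ ball n, f x ≤ c / (1 - r) := by
    have h1r : 0 < 1 - r := by linarith
    have hfix : c + r * (c / (1 - r)) = c / (1 - r) := by field_simp; ring
    intro n
    induction n with
    | zero =>
      have : ball 0 = {1} := by
        ext x
        rw [hball, Finset.mem_singleton, Nat.le_zero, FreeGroup.norm_eq_zero]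
      rw [this, Finset.sum_singleton, le_div_iff₀ h1r]
      have h1 : 0 ≤ ∑ a : α × Bool, Real.exp (-s) := by positivity
      have hf1 : f 1 = 1 := by simp [hf]
      rw [hf1]
      linarith
    | succ n ih =>
      calc _ ≤ _ := hstep n
        _ ≤ c + r * (c / (1 - r)) := by gcongr
        _ = _ := hfix
  refine summable_of_sum_le (fun x => (Real.exp_pos _).le) (c := c / (1 - r)) fun t => ?_
  refine le_trans (Finset.sum_le_sum_of_subset_of_nonneg (t := ball (t.sup FreeGroup.norm))
    (fun x hx => (hball _ _).2 (Finset.le_sup hx)) fun x _ _ => (Real.exp_pos _).le) (hbound _)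

/-- Summing `f` over the `q + 1` neighbours of `x` gives at most `L * f x`, where `L < q + 1`
because `(exp s - 1) * (q - exp s) > 0`. If `f` were summable, translation invariance would make the
total exactly `q + 1` times the sum of `f`. -/
theorem not_summable_exp_neg_mul_norm [Fintype α] [Nonempty α] {s : ℝ} (hs0 : 0 < s)
    (hs : s < Real.log (2 * Fintype.card α - 1)) :
    ¬ Summable fun x : FreeGroup α => Real.exp (-s * FreeGroup.norm x) := by
  intro hsum
  have hcard : (1 : ℝ) ≤ Fintype.card α := by exact_mod_cast Fintype.card_pos
  set f : FreeGroup α → ℝ := fun x => Real.exp (-s * FreeGroup.norm x) with hf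
  set q : ℝ := 2 * Fintype.card α - 1 with hq
  have hqs : Real.exp s < q := (Real.lt_log_iff_exp_lt (by linarith)).1 hs
  have h1s : 1 < Real.exp s := Real.one_lt_exp_iff.2 hs0
  set L : ℝ := Real.exp s + q * Real.exp (-s) with hL
  have hLlt : L < q + 1 := by
    have h1 : Real.exp s * Real.exp (-s) = 1 := by rw [← Real.exp_add]; simp
    have h2 : 0 < Real.exp (-s) := Real.exp_pos _
    have h3 : 0 < (Real.exp s - 1) * (q - Real.exp s) := mul_pos (by linarith) (by linarith)
    have h4 : 0 < (Real.exp s - 1) * (q - Real.exp s) * Real.exp (-s) := mul_pos h3 h2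
    have h5 : (Real.exp s - 1) * (q - Real.exp s) * Real.exp (-s) =
        q * (Real.exp s * Real.exp (-s)) - Real.exp s * (Real.exp s * Real.exp (-s))
          - q * Real.exp (-s) + Real.exp s * Real.exp (-s) := by ring
    rw [h5, h1] at h4
    linarith
  have hstep : ∀ (a : α × Bool) (x : FreeGroup α), f (mk [a] * x) =
      if x.toWord.head? = some (a.1, !a.2) then Real.exp s * f x else Real.exp (-s) * f x := by
    intro a x
    have h := norm_mk_singleton_mul a x
    split_ifs at h ⊢ with hc
    · have h' : (FreeGroup.norm (mk [a] * x) : ℝ) = FreeGroup.norm x - 1 := by exact_mod_cast h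
      simp only [hf]
      rw [h', ← Real.exp_add]; ring_nf
    · have h' : (FreeGroup.norm (mk [a] * x) : ℝ) = FreeGroup.norm x + 1 := by exact_mod_cast h
      simp only [hf]
      rw [h', ← Real.exp_add]; ring_nf
  have hsuper : ∀ x, ∑ a : α × Bool, f (mk [a] * x) ≤ L * f x := by
    intro x
    simp only [hstep]
    by_cases hx : x = 1
    · have hf1 : f 1 = 1 := by simp [hf]
      simp only [hx, toWord_one, List.head?_nil, reduceCtorEq, if_false, hf1, mul_one,
        Finset.sum_const, Finset.card_univ, Fintype.card_prod, Fintype.card_bool, nsmul_eq_mul]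
      have : Real.exp (-s) ≤ Real.exp s := Real.exp_le_exp.2 (by linarith)
      push_cast
      rw [hL, hq]
      linarith
    · rw [sum_letter_ite hx]
      exact le_of_eq (by rw [hL]; ring)
  have hshift : ∀ a : α × Bool, Summable fun x => f (mk [a] * x) := fun a =>
    hsum.comp_injective (mul_right_injective _)
  have htotal : ∑' x, ∑ a : α × Bool, f (mk [a] * x) = (q + 1) * ∑' x, f x := by
    rw [Summable.tsum_finsetSum fun a _ => hshift a]
    have : ∀ a : α × Bool, ∑' x, f (mk [a] * x) = ∑' x, f x := fun a =>
      (Equiv.mulLeft (mk [a] : FreeGroup α)).tsum_eq f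
    simp only [this, Finset.sum_const, Finset.card_univ, Fintype.card_prod, Fintype.card_bool,
      nsmul_eq_mul]
    push_cast
    rw [hq]
    ring
  have hle : ∑' x, ∑ a : α × Bool, f (mk [a] * x) ≤ ∑' x, L * f x :=
    Summable.tsum_le_tsum hsuper (summable_sum fun a _ => hshift a) (hsum.mul_left L)
  rw [htotal, tsum_mul_left] at hle
  have hpos : 0 < ∑' x, f x := hsum.tsum_pos (fun x => (Real.exp_pos _).le) 1 (Real.exp_pos _)
  nlinarith

end Growth

/-! ### Critical exponents -/

section CriticalExponent

open FreeGroup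

theorem poincareSeries_ne_top_iff {α : Type*} [DecidableEq α] {s : ℝ}
    {H : Subgroup (FreeGroup α)} : poincareSeries s H ≠ ∞ ↔
      Summable fun γ : H => Real.exp (-s * (FreeGroup.norm (γ : FreeGroup α) : ℝ)) := by
  refine ⟨fun h => ?_, fun h => h.tsum_ofReal_ne_top⟩
  refine (ENNReal.summable_toReal h).congr fun γ => ?_
  exact ENNReal.toReal_ofReal (Real.exp_pos _).le

theorem poincareSeries_top {α : Type*} [DecidableEq α] (s : ℝ) :
    poincareSeries s (⊤ : Subgroup (FreeGroup α)) =
      ∑' x : FreeGroup α, ENNReal.ofReal (Real.exp (-s * FreeGroup.norm x)) := by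
  rw [poincareSeries_eq_tsum_indicator]
  simp

theorem poincareSeries_top_ne_top_iff {α : Type*} [DecidableEq α] {s : ℝ} :
    poincareSeries s (⊤ : Subgroup (FreeGroup α)) ≠ ∞ ↔
      Summable fun x : FreeGroup α => Real.exp (-s * FreeGroup.norm x) := by
  rw [poincareSeries_top]
  refine ⟨fun h => ?_, fun h => h.tsum_ofReal_ne_top⟩
  refine (ENNReal.summable_toReal h).congr fun γ => ?_
  exact ENNReal.toReal_ofReal (Real.exp_pos _).le

/-- Finitely many cosets cover the group, and each contributes at most a constant times the series
of `H`. -/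
theorem poincareSeries_finiteIndex_eq_top {α : Type*} [Fintype α] [Nonempty α] [DecidableEq α]
    (H : Subgroup (FreeGroup α)) [H.FiniteIndex] {s : ℝ} (hs0 : 0 < s)
    (hs : s < Real.log (2 * Fintype.card α - 1)) : poincareSeries s H = ∞ := by
  by_contra hH
  apply not_summable_exp_neg_mul_norm (α := α) hs0 hs
  rw [← poincareSeries_top_ne_top_iff, poincareSeries_top]
  have hfin : Finite (FreeGroup α ⧸ H) := inferInstance
  have := Fintype.ofFinite (FreeGroup α ⧸ H)
  have hle : (∑' x : FreeGroup α, ENNReal.ofReal (Real.exp (-s * FreeGroup.norm x))) ≤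
      (∑' c : FreeGroup α ⧸ H, ENNReal.ofReal (Real.exp (s * FreeGroup.norm c.out))) *
        poincareSeries s H := by
    have hsurj : Function.Surjective fun p : (FreeGroup α ⧸ H) × H =>
        p.1.out * (p.2 : FreeGroup α) := fun x =>
      ⟨(x, ⟨((x : FreeGroup α ⧸ H).out)⁻¹ * x, QuotientGroup.eq.1 (QuotientGroup.out_eq' _)⟩),
        mul_inv_cancel_left _ _⟩
    refine (ENNReal.tsum_le_tsum_comp_of_surjective hsurj _).trans ?_
    rw [ENNReal.tsum_prod', ← ENNReal.tsum_mul_right]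
    refine ENNReal.tsum_le_tsum fun c => ?_
    rw [poincareSeries, ← ENNReal.tsum_mul_left]
    refine ENNReal.tsum_le_tsum fun h => ?_
    rw [← ENNReal.ofReal_mul (Real.exp_pos _).le, ← Real.exp_add]
    apply ENNReal.ofReal_le_ofReal
    apply Real.exp_le_exp.2
    have h1 := norm_mul_le (c.out)⁻¹ (c.out * (h : FreeGroup α))
    rw [inv_mul_cancel_left, norm_inv_eq] at h1
    have h2 : (FreeGroup.norm (h : FreeGroup α) : ℝ) ≤
        FreeGroup.norm c.out + FreeGroup.norm (c.out * (h : FreeGroup α)) := by exact_mod_cast h1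
    nlinarith
  refine (hle.trans_lt (ENNReal.mul_lt_top ?_ (lt_top_iff_ne_top.2 hH))).ne
  rw [tsum_fintype]
  exact ENNReal.sum_lt_top.2 fun c _ => ENNReal.ofReal_lt_top

variable {d : ℕ}

theorem criticalExponent_nonneg (H : Subgroup (FreeGroup (Fin d))) : 0 ≤ criticalExponent H :=
  Real.sInf_nonneg fun _ hs => hs.1.le

theorem criticalExponent_le {H : Subgroup (FreeGroup (Fin d))} {s : ℝ} (hs : 0 < s)
    (hH : poincareSeries s H ≠ ∞) : criticalExponent H ≤ s :=
  csInf_le ⟨0, fun _ hs => hs.1.le⟩ ⟨hs, poincareSeries_ne_top_iff.1 hH⟩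

theorem poincareSeries_ne_top (hd : 1 ≤ d) (H : Subgroup (FreeGroup (Fin d))) {s : ℝ}
    (hs : Real.log (2 * (d : ℝ) - 1) < s) : poincareSeries s H ≠ ∞ := by
  have : Nonempty (Fin d) := ⟨⟨0, hd⟩⟩
  refine ((poincareSeries_mono s le_top).trans_lt (lt_top_iff_ne_top.2 ?_)).ne
  rw [poincareSeries_top_ne_top_iff]
  exact summable_exp_neg_mul_norm (by simpa using hs)

theorem log_two_mul_sub_one_nonneg (hd : 1 ≤ d) : 0 ≤ Real.log (2 * (d : ℝ) - 1) := by
  have : (1 : ℝ) ≤ d := by exact_mod_cast hd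
  exact Real.log_nonneg (by linarith)

theorem criticalExponent_le_log (hd : 1 ≤ d) (H : Subgroup (FreeGroup (Fin d))) :
    criticalExponent H ≤ Real.log (2 * (d : ℝ) - 1) :=
  le_of_forall_gt_imp_ge_of_dense fun _ hs =>
    criticalExponent_le ((log_two_mul_sub_one_nonneg hd).trans_lt hs) (poincareSeries_ne_top hd H hs)

theorem nonempty_convergence_set (hd : 1 ≤ d) (H : Subgroup (FreeGroup (Fin d))) :
    {s : ℝ | 0 < s ∧ Summable fun γ : H =>
      Real.exp (-s * (FreeGroup.norm (γ : FreeGroup (Fin d)) : ℝ))}.Nonempty := by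
  obtain ⟨s, hs⟩ := exists_gt (Real.log (2 * (d : ℝ) - 1))
  exact ⟨s, (log_two_mul_sub_one_nonneg hd).trans_lt hs,
    poincareSeries_ne_top_iff.1 (poincareSeries_ne_top hd H hs)⟩

theorem le_criticalExponent (hd : 1 ≤ d) {H : Subgroup (FreeGroup (Fin d))} {t : ℝ}
    (h : ∀ s, 0 < s → poincareSeries s H ≠ ∞ → t ≤ s) : t ≤ criticalExponent H :=
  le_csInf (nonempty_convergence_set hd H) fun s hs => h s hs.1 (poincareSeries_ne_top_iff.2 hs.2)

theorem criticalExponent_mono (hd : 1 ≤ d) {H K : Subgroup (FreeGroup (Fin d))} (h : H ≤ K) :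
    criticalExponent H ≤ criticalExponent K :=
  le_criticalExponent hd fun _ hs hK =>
    criticalExponent_le hs ((poincareSeries_mono _ h).trans_lt (lt_top_iff_ne_top.2 hK)).ne

theorem exists_poincareSeries_ne_top (hd : 1 ≤ d) (H : Subgroup (FreeGroup (Fin d))) {t : ℝ}
    (ht : criticalExponent H < t) : ∃ s, 0 < s ∧ s < t ∧ poincareSeries s H ≠ ∞ := by
  obtain ⟨s, hs, hst⟩ := exists_lt_of_csInf_lt (nonempty_convergence_set hd H) ht
  exact ⟨s, hs.1, hst, poincareSeries_ne_top_iff.2 hs.2⟩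

/-- A finitely generated subgroup is contained in boomerang subgroups of critical exponent
arbitrarily close to its own. -/
theorem exists_isBoomerang_criticalExponent (hd : 1 ≤ d) {H : Subgroup (FreeGroup (Fin d))}
    (hH : H.FG) {t : ℝ} (ht : criticalExponent H < t) :
    ∃ K : Subgroup (FreeGroup (Fin d)), IsBoomerang K ∧
      criticalExponent H ≤ criticalExponent K ∧ criticalExponent K < t := by
  obtain ⟨s, hs, hst, hP⟩ := exists_poincareSeries_ne_top hd H ht
  obtain ⟨K, hK, hHK, hKP⟩ := exists_isBoomerang_poincareSeries_ne_top hs hH hP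
  exact ⟨K, hK, criticalExponent_mono hd hHK, (criticalExponent_le hs hKP).trans_lt hst⟩

end CriticalExponent

/-! ### Finite quotients of large girth -/

section FiniteQuotient

open FreeGroup

/-- A homomorphism to a finite group which is nontrivial on a given ball without its centre. -/
theorem exists_finite_group_hom.{u} {α : Type u} [Finite α] [DecidableEq α] (n : ℕ) :
    ∃ (X : Type u) (_ : Fintype X) (ρ : FreeGroup α →* Equiv.Perm X),
      ∀ w : FreeGroup α, w ≠ 1 → FreeGroup.norm w ≤ n → ρ w ≠ 1 := by
  classical
  let X := {x : FreeGroup α // FreeGroup.norm x ≤ n}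
  have hfin : Fintype X := (finite_norm_le (α := α) n).fintype
  have hσ : ∀ i : α, ∃ σ : Equiv.Perm X, ∀ x y : X, of i * x.1 = y.1 → σ x = y := by
    intro i
    -- Left multiplication by a generator is a partial injection of the ball and extends to a
    -- permutation. A word of length at most `n` then carries `1` to itself without leaving the
    -- ball.
    let e : {x : X // FreeGroup.norm (of i * x.1) ≤ n} ≃
        {x : X // FreeGroup.norm ((of i)⁻¹ * x.1) ≤ n} :=
      { toFun := fun x => ⟨⟨of i * x.1.1, x.2⟩, by simpa using x.1.2⟩
        invFun := fun x => ⟨⟨(of i)⁻¹ * x.1.1, x.2⟩, by simpa using x.1.2⟩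
        left_inv := fun x => by ext; simp
        right_inv := fun x => by ext; simp }
    refine ⟨e.extendSubtype, fun x y hxy => ?_⟩
    have hx : FreeGroup.norm (of i * x.1) ≤ n := by rw [hxy]; exact y.2
    rw [e.extendSubtype_apply_of_mem x hx]
    exact Subtype.ext hxy
  choose σ hσ using hσ
  refine ⟨X, hfin, FreeGroup.lift σ, fun w hw hwn hρ => hw ?_⟩
  have horbit : ∀ L : List (α × Bool), L.length ≤ n → ∀ x : X, x.1 = 1 →
      (FreeGroup.lift σ (mk L) x).1 = mk L := by
    intro L
    induction L with
    | nil => exact fun _ x hx => hx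
    | cons a L ih =>
      intro hL x hx
      have hsplit : (mk (a :: L) : FreeGroup α) = mk [a] * mk L := by simp
      have hL' : L.length ≤ n := by simp at hL; omega
      have hih := ih hL' x hx
      have hnorm : FreeGroup.norm (mk (a :: L) : FreeGroup α) ≤ n := norm_mk_le.trans hL
      rw [hsplit] at hnorm ⊢
      rw [_root_.map_mul, Equiv.Perm.mul_apply]
      obtain ⟨i, b⟩ := a
      cases b
      · have hinv : (mk [(i, false)] : FreeGroup α) = (of i)⁻¹ := rfl
        rw [hinv] at hnorm ⊢
        have := hσ i ⟨_, hnorm⟩ (FreeGroup.lift σ (mk L) x)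
          (by rw [hih, mul_inv_cancel_left])
        rw [_root_.map_inv, lift_apply_of, ← this, Equiv.Perm.inv_eq_iff_eq.2 rfl]
      · have hof : (mk [(i, true)] : FreeGroup α) = of i := rfl
        rw [hof] at hnorm ⊢
        rw [lift_apply_of, hσ i (FreeGroup.lift σ (mk L) x) ⟨_, hnorm⟩ (by rw [hih])]
  have h1 := horbit w.toWord hwn ⟨1, by simp⟩ rfl
  rw [mk_toWord, hρ] at h1
  exact h1.symm

end FiniteQuotient

/-! ### Stretching the edges of a finite Cayley graph -/

section Stretching

open FreeGroup

variable {α G : Type*} [Group G] (ρ : FreeGroup α →* G)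

/-- The edge of the Cayley graph of `G` crossed by a letter read at the vertex `x`. -/
def edgeAt (x : G) (a : α × Bool) : G × α := if a.2 then (x, a.1) else (ρ (of a.1) * x, a.1)

/-- The path labelled by a word in the Cayley graph of `G`, after replacing each edge `e` by
a path of length `ℓ e` all of whose edges have the label of `e`. -/
def stretch (ℓ : G × α → ℕ) : G → List (α × Bool) → List (α × Bool)
  | _, [] => []
  | x, a :: L => List.replicate (ℓ (edgeAt ρ x a)) a ++ stretch ℓ ((ρ (mk [a]))⁻¹ * x) L

/-- The wreath product homomorphism recording the labels of stretched paths. -/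
def stretchHom (ℓ : G × α → ℕ) : FreeGroup α →* RegularWreathProduct (FreeGroup α) G :=
  FreeGroup.lift fun i => ⟨fun x => of i ^ ℓ (x, i), ρ (of i)⟩

theorem stretchHom_right (ℓ : G × α → ℕ) (w : FreeGroup α) : (stretchHom ρ ℓ w).right = ρ w := by
  have : RegularWreathProduct.rightHom.comp (stretchHom ρ ℓ) = ρ := by
    ext i
    simp [stretchHom]
  exact DFunLike.congr_fun this w

theorem stretchHom_mk_left (ℓ : G × α → ℕ) (x : G) (L : List (α × Bool)) :
    (stretchHom ρ ℓ (mk L)).left x = mk (stretch ρ ℓ x L) := by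
  induction L generalizing x with
  | nil =>
    have hnil : (mk [] : FreeGroup α) = 1 := rfl
    rw [hnil, _root_.map_one]; rfl
  | cons a L ih =>
    have hsplit : (mk (a :: L) : FreeGroup α) = mk [a] * mk L := by simp
    rw [hsplit, _root_.map_mul, RegularWreathProduct.mul_left, Pi.mul_apply, ih, stretchHom_right,
      stretch, ← mul_mk]
    congr 1
    obtain ⟨i, b⟩ := a
    have hpow : ∀ n : ℕ, of i ^ n = mk (List.replicate n (i, true)) := by
      intro n
      induction n with
      | zero => rfl
      | succ n ih => rw [pow_succ', ih, List.replicate_succ]; rfl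
    cases b
    · have hinv : (mk [(i, false)] : FreeGroup α) = (of i)⁻¹ := rfl
      rw [hinv, _root_.map_inv, RegularWreathProduct.inv_left]
      simp [stretchHom, edgeAt, hpow, invRev]
    · have hof : (mk [(i, true)] : FreeGroup α) = of i := rfl
      rw [hof]
      simp [stretchHom, edgeAt, hpow]

theorem length_stretch_add (ℓ m : G × α → ℕ) (x : G) (L : List (α × Bool)) :
    (stretch ρ (ℓ + m) x L).length = (stretch ρ ℓ x L).length + (stretch ρ m x L).length := by
  induction L generalizing x with
  | nil => rfl
  | cons a L ih => simp [stretch, ih]; ring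

theorem length_stretch_const (n : ℕ) (x : G) (L : List (α × Bool)) :
    (stretch ρ (fun _ => n) x L).length = n * L.length := by
  induction L generalizing x with
  | nil => rfl
  | cons a L ih => simp [stretch, ih]; ring

theorem length_le_length_stretch {ℓ : G × α → ℕ} (hℓ : ∀ e, 1 ≤ ℓ e) (x : G)
    (L : List (α × Bool)) : L.length ≤ (stretch ρ ℓ x L).length := by
  induction L generalizing x with
  | nil => exact le_rfl
  | cons a L ih =>
    have h1 := ih ((ρ (mk [a]))⁻¹ * x)
    have h2 := hℓ (edgeAt ρ x a)
    simp only [stretch, List.length_cons, List.length_append, List.length_replicate]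
    omega

theorem head?_stretch {ℓ : G × α → ℕ} (hℓ : ∀ e, 1 ≤ ℓ e) (x : G) (L : List (α × Bool)) :
    (stretch ρ ℓ x L).head? = L.head? := by
  cases L with
  | nil => rfl
  | cons a L =>
    obtain ⟨n, hn⟩ := Nat.exists_eq_add_of_le (hℓ (edgeAt ρ x a))
    rw [stretch, hn, add_comm, List.replicate_succ]
    rfl

/-- Positive lengths keep every letter, so consecutive blocks meet in the same pairs of letters as
the original word. -/
theorem isReduced_stretch {ℓ : G × α → ℕ} (hℓ : ∀ e, 1 ≤ ℓ e) (x : G) {L : List (α × Bool)}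
    (hL : IsReduced L) : IsReduced (stretch ρ ℓ x L) := by
  induction L generalizing x with
  | nil => exact IsReduced.nil
  | cons a L ih =>
    have hL' : IsReduced L := hL.infix (List.suffix_cons a L).isInfix
    rw [stretch, FreeGroup.IsReduced, List.isChain_append]
    refine ⟨List.isChain_replicate_of_rel _ fun _ => rfl, ih _ hL', fun b hb c hc => ?_⟩
    rw [head?_stretch ρ hℓ] at hc
    have hb' : b = a := List.eq_of_mem_replicate (List.mem_of_getLast? hb)
    subst hb'
    cases L with
    | nil => simp at hc
    | cons c' L =>
      obtain rfl : c' = c := by simpa using hc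
      exact (isReduced_cons_cons.1 hL).1

theorem stretch_append (ℓ : G × α → ℕ) (x : G) (A B : List (α × Bool)) :
    stretch ρ ℓ x (A ++ B) = stretch ρ ℓ x A ++ stretch ρ ℓ ((ρ (mk A))⁻¹ * x) B := by
  induction A generalizing x with
  | nil =>
    have hnil : (mk [] : FreeGroup α) = 1 := rfl
    simp [stretch, hnil]
  | cons a A ih =>
    have hsplit : (mk (a :: A) : FreeGroup α) = mk [a] * mk A := by simp
    rw [hsplit, _root_.map_mul, mul_inv_rev, mul_assoc, List.cons_append, stretch, stretch, ih,
      List.append_assoc]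

/-- With lengths `Pi.single e 1`, the stretched length counts the crossings of `e`. -/
theorem exists_crossing [DecidableEq α] [DecidableEq G] {e : G × α} {x : G} {L : List (α × Bool)}
    (h : (stretch ρ (Pi.single e 1) x L).length ≠ 0) :
    ∃ A b B, L = A ++ b :: B ∧ edgeAt ρ ((ρ (mk A))⁻¹ * x) b = e := by
  induction L generalizing x with
  | nil => exact absurd rfl h
  | cons a L ih =>
    by_cases ha : edgeAt ρ x a = e
    · exact ⟨[], a, L, rfl, by rwa [show (mk [] : FreeGroup α) = 1 from rfl, _root_.map_one, inv_one, one_mul]⟩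
    · have : (stretch ρ (Pi.single e 1) ((ρ (mk [a]))⁻¹ * x) L).length ≠ 0 := by
        simpa [stretch, ha] using h
      obtain ⟨A, b, B, rfl, hb⟩ := ih this
      have hsplit : (mk (a :: A) : FreeGroup α) = mk [a] * mk A := by simp
      exact ⟨a :: A, b, B, rfl, by rw [hsplit, _root_.map_mul, mul_inv_rev, mul_assoc]; exact hb⟩

variable [DecidableEq α]

/-- A second crossing in the same direction would close up `a :: A`, one in the opposite direction
would close up `A`. Reduced closed paths this short are empty, and an empty `A` in the second case
would be a backtrack. -/
theorem length_stretch_single_eq_zero [DecidableEq G] {N : ℕ}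
    (hρ : ∀ w : FreeGroup α, w ≠ 1 → FreeGroup.norm w ≤ N → ρ w ≠ 1) {e : G × α} {x : G}
    {a : α × Bool} {L : List (α × Bool)} (hL : IsReduced (a :: L)) (hN : L.length + 1 ≤ N)
    (ha : edgeAt ρ x a = e) :
    (stretch ρ (Pi.single e 1) ((ρ (mk [a]))⁻¹ * x) L).length = 0 := by
  by_contra hne
  obtain ⟨A, b, B, rfl, hb⟩ := exists_crossing ρ hne
  have hlen : A.length + 1 ≤ N := by simp at hN; omega
  have hA : IsReduced (a :: A) := hL.infix ⟨[], b :: B, by simp⟩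
  have hA' : IsReduced A := hA.infix (List.suffix_cons a A).isInfix
  have hone : ∀ {M : List (α × Bool)}, IsReduced M → M.length ≤ N → ρ (mk M) = 1 → M = [] := by
    intro M hM hMN h1
    by_contra hne
    refine hρ (mk M) (fun h => hne ?_) (norm_mk_le.trans hMN) h1
    rw [← hM.reduce_eq, ← toWord_mk, h, toWord_one]
  have hcase1 : ρ (mk (a :: A)) ≠ 1 := fun h => by
    simpa using hone hA (by simpa using hlen) h
  have hcase2 : b.1 = a.1 → b.2 = (!a.2) → ρ (mk A) ≠ 1 := by
    intro h1 h2 h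
    obtain rfl := hone hA' (by omega) h
    have := (isReduced_cons_cons.1 hL).1 h1.symm
    rw [h2] at this
    simp at this
  have hsplit : (mk (a :: A) : FreeGroup α) = mk [a] * mk A := by simp
  rw [hsplit, _root_.map_mul] at hcase1
  rw [← ha] at hb
  obtain ⟨i, ε⟩ := a
  obtain ⟨j, η⟩ := b
  have hinv : (mk [(i, false)] : FreeGroup α) = (of i)⁻¹ := rfl
  have hof : (mk [(i, true)] : FreeGroup α) = of i := rfl
  cases ε <;> cases η <;> simp [edgeAt, hinv, hof] at hb hcase1 hcase2
  · obtain ⟨hb, rfl⟩ := hb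
    rw [mul_right_inj, ← mul_assoc, mul_eq_right] at hb
    apply hcase1
    rw [← inv_inj, mul_inv_rev, inv_inv, inv_one, hb]
  · obtain ⟨hb, rfl⟩ := hb
    exact hcase2 rfl hb
  · obtain ⟨hb, rfl⟩ := hb
    apply hcase2 rfl
    rw [← mul_assoc, ← mul_assoc, mul_eq_right, mul_inv_eq_one] at hb
    simpa using hb
  · obtain ⟨hb, rfl⟩ := hb
    rw [← mul_assoc, mul_eq_right] at hb
    apply hcase1
    rw [← inv_inj, mul_inv_rev, inv_one, hb]

/-- If the Cayley graph has large girth, then reduced paths cross a given edge rarely. -/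
theorem mul_length_stretch_single_le [DecidableEq G] {N : ℕ} (hN : 1 ≤ N)
    (hρ : ∀ w : FreeGroup α, w ≠ 1 → FreeGroup.norm w ≤ N → ρ w ≠ 1) (e : G × α) (x : G)
    {L : List (α × Bool)} (hL : IsReduced L) :
    N * (stretch ρ (Pi.single e 1) x L).length ≤ L.length + N := by
  induction hn : L.length using Nat.strong_induction_on generalizing L x with
  | _ n ih =>
    subst hn
    cases L with
    | nil => simp [stretch]
    | cons a L =>
      have hL' : IsReduced L := hL.infix (List.suffix_cons a L).isInfix
      by_cases ha : edgeAt ρ x a = e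
      -- The crossing and the next `N - 1` letters form a block with one crossing; an incomplete
      -- last block is paid for by the summand `N`.
      · set A := L.take (N - 1) with hA
        set B := L.drop (N - 1) with hB
        have hAB : L = A ++ B := (List.take_append_drop _ _).symm
        have hAlen : A.length + 1 ≤ N := by
          have : A.length ≤ N - 1 := List.length_take_le _ _
          omega
        have hAred : IsReduced (a :: A) := hL.infix ⟨[], B, by simp [hAB]⟩
        have h0 := length_stretch_single_eq_zero ρ hρ hAred hAlen ha
        have hBred : IsReduced B := hL'.infix (List.drop_suffix _ _).isInfix
        have hBlen : B.length = L.length - (N - 1) := List.length_drop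
        have hB' := ih B.length (by simp only [List.length_cons]; omega)
          ((ρ (mk A))⁻¹ * ((ρ (mk [a]))⁻¹ * x)) hBred rfl
        have hcount : (stretch ρ (Pi.single e 1) x (a :: L)).length =
            1 + (stretch ρ (Pi.single e 1) ((ρ (mk A))⁻¹ * ((ρ (mk [a]))⁻¹ * x)) B).length := by
          rw [stretch, hAB, stretch_append, List.length_append, List.length_append, h0, ha]
          simp
        rw [hcount, List.length_cons, mul_add]
        by_cases hlong : N - 1 ≤ L.length
        · omega
        · have : B = [] := List.eq_nil_of_length_eq_zero (by omega)
          rw [this]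
          simp [stretch]
      · have h1 := ih L.length (by simp) ((ρ (mk [a]))⁻¹ * x) hL' rfl
        have hcount : (stretch ρ (Pi.single e 1) x (a :: L)).length =
            (stretch ρ (Pi.single e 1) ((ρ (mk [a]))⁻¹ * x) L).length := by
          simp [stretch, ha]
        rw [hcount, List.length_cons]
        omega

/-- The homomorphism mapping a closed path at `1` to the label of the stretched path. -/
def stretchKerHom (ℓ : G × α → ℕ) : ρ.ker →* FreeGroup α where
  toFun w := (stretchHom ρ ℓ w).left 1
  map_one' := by simp
  map_mul' v w := by
    have hv : ρ v = 1 := v.2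
    simp [stretchHom_right, hv]

theorem norm_stretchKerHom {ℓ : G × α → ℕ} (hℓ : ∀ e, 1 ≤ ℓ e) (w : ρ.ker) :
    FreeGroup.norm (stretchKerHom ρ ℓ w) = (stretch ρ ℓ 1 (w : FreeGroup α).toWord).length := by
  have : stretchKerHom ρ ℓ w = mk (stretch ρ ℓ 1 (w : FreeGroup α).toWord) := by
    rw [← stretchHom_mk_left, mk_toWord]
    rfl
  rw [this, FreeGroup.norm, toWord_mk, (isReduced_stretch ρ hℓ 1 isReduced_toWord).reduce_eq]

theorem stretchKerHom_injective {ℓ : G × α → ℕ} (hℓ : ∀ e, 1 ≤ ℓ e) :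
    Function.Injective (stretchKerHom ρ ℓ) := by
  rw [injective_iff_map_eq_one]
  intro w hw
  have h1 := norm_stretchKerHom ρ hℓ w
  have h2 := length_le_length_stretch ρ hℓ 1 (w : FreeGroup α).toWord
  rw [hw, FreeGroup.norm_one] at h1
  have h3 : FreeGroup.norm (w : FreeGroup α) = 0 := by
    rw [FreeGroup.norm]; omega
  exact Subtype.ext (FreeGroup.norm_eq_zero.1 h3)

theorem poincareSeries_range_stretchKerHom {ℓ : G × α → ℕ} (hℓ : ∀ e, 1 ≤ ℓ e) (s : ℝ) :
    poincareSeries s (stretchKerHom ρ ℓ).range = ∑' w : ρ.ker, ENNReal.ofReal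
      (Real.exp (-s * (stretch ρ ℓ 1 (w : FreeGroup α).toWord).length)) := by
  rw [poincareSeries, ← (MonoidHom.ofInjective (stretchKerHom_injective ρ hℓ)).toEquiv.tsum_eq]
  refine tsum_congr fun w => ?_
  rw [← norm_stretchKerHom ρ hℓ]
  rfl

theorem poincareSeries_range_stretchKerHom_const {n : ℕ} (hn : 1 ≤ n) (s : ℝ) :
    poincareSeries s (stretchKerHom ρ fun _ => n).range = poincareSeries (s * n) ρ.ker := by
  rw [poincareSeries_range_stretchKerHom ρ (fun _ => hn), poincareSeries]
  refine tsum_congr fun w => ?_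
  rw [length_stretch_const, FreeGroup.norm]
  push_cast
  ring_nf

/-- Increasing the length of one edge of a graph of large girth shrinks the critical exponent at
most by a factor close to one. -/
theorem poincareSeries_range_stretchKerHom_add_single [DecidableEq G] {N : ℕ} (hN : 1 ≤ N)
    (hρ : ∀ w : FreeGroup α, w ≠ 1 → FreeGroup.norm w ≤ N → ρ w ≠ 1) {ℓ : G × α → ℕ}
    (hℓ : ∀ e, 1 ≤ ℓ e) (e : G × α) {s : ℝ} (hs : 0 < s)
    (h : poincareSeries s (stretchKerHom ρ (ℓ + Pi.single e 1)).range ≠ ∞) :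
    poincareSeries (s * (1 + 1 / N)) (stretchKerHom ρ ℓ).range ≠ ∞ := by
  rw [poincareSeries_range_stretchKerHom ρ hℓ]
  rw [poincareSeries_range_stretchKerHom ρ (ℓ := ℓ + Pi.single e 1)
    fun e' => (hℓ e').trans (Nat.le_add_right _ _)] at h
  -- With old length `m` and `c` crossings, `c ≤ m / N + 1`; the additive `1` produces the factor
  -- `exp s`.
  refine ne_top_of_le_ne_top (ENNReal.mul_ne_top (ENNReal.ofReal_ne_top (r := Real.exp s)) h) ?_
  rw [← ENNReal.tsum_mul_left]
  refine ENNReal.tsum_le_tsum fun w => ?_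
  rw [← ENNReal.ofReal_mul (Real.exp_pos _).le, ← Real.exp_add]
  apply ENNReal.ofReal_le_ofReal
  apply Real.exp_le_exp.2
  rw [length_stretch_add]
  have h1 := mul_length_stretch_single_le ρ hN hρ e 1 (isReduced_toWord (x := (w : FreeGroup α)))
  have h2 := length_le_length_stretch ρ hℓ 1 (w : FreeGroup α).toWord
  set c := (stretch ρ (Pi.single e 1) 1 (w : FreeGroup α).toWord).length
  set m := (stretch ρ ℓ 1 (w : FreeGroup α).toWord).length
  have hN0 : (0 : ℝ) < N := by exact_mod_cast hN
  have h3 : (N : ℝ) * c ≤ m + N := by exact_mod_cast h1.trans (Nat.add_le_add_right h2 N)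
  have h4 : (c : ℝ) ≤ m * (1 / N) + 1 := by
    rw [mul_one_div, ← div_self hN0.ne', ← add_div, le_div_iff₀ hN0]
    linarith
  have h5 := mul_le_mul_of_nonneg_left h4 hs.le
  push_cast
  linarith

end Stretching

/-! ### Density of the critical exponents -/

section Density

open FreeGroup

/-- The kernel has finite index in a finitely generated group, hence is finitely generated, and so
is its image. -/
theorem fg_range_stretchKerHom {α G : Type*} [Finite α] [Finite G] [Group G]
    (ρ : FreeGroup α →* G) (ℓ : G × α → ℕ) : (stretchKerHom ρ ℓ).range.FG := by
  rw [← Group.fg_iff_subgroup_fg]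
  infer_instance

/-- The critical exponents of finitely generated subgroups are dense. -/
theorem exists_fg_criticalExponent {d : ℕ} (hd : 1 ≤ d) {t ε : ℝ} (ht0 : 0 ≤ t)
    (ht : t ≤ Real.log (2 * (d : ℝ) - 1)) (hε : 0 < ε) :
    ∃ H : Subgroup (FreeGroup (Fin d)), H.FG ∧ t ≤ criticalExponent H ∧
      criticalExponent H < t + ε := by
  classical
  have hne : Nonempty (Fin d) := ⟨⟨0, hd⟩⟩
  set q := Real.log (2 * (d : ℝ) - 1) with hq
  have hq0 : 0 ≤ q := log_two_mul_sub_one_nonneg hd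
  obtain ⟨N, hNq⟩ := exists_nat_gt (q / ε)
  have hN0 : (0 : ℝ) < N := (div_nonneg hq0 hε.le).trans_lt hNq
  have hN : 1 ≤ N := by exact_mod_cast hN0
  have hqN : q / N < ε := by
    rw [div_lt_iff₀ hε] at hNq
    rw [div_lt_iff₀ hN0, mul_comm]
    exact hNq
  obtain ⟨X, _, ρ, hρ⟩ := exists_finite_group_hom (α := Fin d) N
  set δ : (Equiv.Perm X × Fin d → ℕ) → ℝ := fun ℓ => criticalExponent (stretchKerHom ρ ℓ).range
    with hδ
  have hδq : ∀ ℓ, δ ℓ ≤ q := fun ℓ => criticalExponent_le_log hd _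
  set S : Set (Equiv.Perm X × Fin d → ℕ) := {ℓ | ℓ ∈ Set.Icc (fun _ => 1) (fun _ => N) ∧ t ≤ δ ℓ}
    with hS
  have hSfin : S.Finite := (Set.finite_Icc _ _).subset fun ℓ hℓ => hℓ.1
  have hSne : S.Nonempty := by
    refine ⟨fun _ => 1, ⟨le_rfl, fun _ => hN⟩, ht.trans (le_criticalExponent hd fun s hs hP => ?_)⟩
    rw [poincareSeries_range_stretchKerHom_const ρ le_rfl, Nat.cast_one, mul_one] at hP
    by_contra! hlt
    exact hP (poincareSeries_finiteIndex_eq_top _ hs (by simpa using hlt))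
  -- Discrete intermediate value: by maximality, lengthening any edge still shorter than `N` pushes
  -- the exponent below `t`, and one such step costs at most `q / N < ε`.
  obtain ⟨ℓ, hℓS, hmax⟩ := Set.exists_max_image S (fun ℓ => ∑ e, ℓ e) hSfin hSne
  have hℓ1 : ∀ e, 1 ≤ ℓ e := hℓS.1.1
  have hℓN : ∀ e, ℓ e ≤ N := hℓS.1.2
  refine ⟨(stretchKerHom ρ ℓ).range, fg_range_stretchKerHom ρ ℓ, hℓS.2, ?_⟩
  change δ ℓ < t + ε
  by_cases hconst : ∀ e, ℓ e = N
  · have hle : δ ℓ ≤ q / N := by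
      obtain rfl : ℓ = fun _ => N := funext hconst
      refine le_of_forall_gt_imp_ge_of_dense fun s hs => ?_
      have hs0 : 0 < s := (div_nonneg hq0 hN0.le).trans_lt hs
      refine criticalExponent_le hs0 ?_
      rw [poincareSeries_range_stretchKerHom_const ρ hN]
      exact poincareSeries_ne_top hd _ ((div_lt_iff₀ hN0).1 hs)
    linarith
  · push Not at hconst
    obtain ⟨e, he⟩ := hconst
    set ℓ' := ℓ + Pi.single e 1 with hℓ'
    have hlt : δ ℓ' < t := by
      by_contra! hge
      have hmem : ℓ' ∈ S := by
        refine ⟨⟨fun e' => (hℓ1 e').trans (Nat.le_add_right _ _), fun e' => ?_⟩, hge⟩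
        by_cases hee : e' = e
        · subst hee
          have := hℓN e'
          simp only [hℓ', Pi.add_apply, Pi.single_eq_same]
          omega
        · simpa [hℓ', hee] using hℓN e'
      have := hmax ℓ' hmem
      simp [hℓ', Finset.sum_add_distrib] at this
    have hstep : δ ℓ ≤ δ ℓ' * (1 + 1 / N) := by
      have hpos : (0 : ℝ) < 1 + 1 / N := by positivity
      rw [← div_le_iff₀ hpos]
      refine le_criticalExponent hd fun s hs hP => ?_
      rw [div_le_iff₀ hpos]
      exact criticalExponent_le (mul_pos hs hpos)
        (poincareSeries_range_stretchKerHom_add_single ρ hN hρ hℓ1 e hs hP)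
    have hqN' : δ ℓ' * (1 / N) ≤ q / N := by
      rw [mul_one_div]
      exact div_le_div_of_nonneg_right (hδq _) hN0.le
    linarith

theorem isDenseIn_criticalExponent_boom (d : ℕ) (hd : 1 ≤ d) :
    IsDenseIn (criticalExponent '' Boom d) (Set.Icc 0 (Real.log (2 * (d : ℝ) - 1))) := by
  refine ⟨?_, fun t ht => Metric.mem_closure_iff.2 fun ε hε => ?_⟩
  · rintro _ ⟨H, -, rfl⟩
    exact ⟨criticalExponent_nonneg H, criticalExponent_le_log hd H⟩
  · obtain ⟨H, hH, htH, hHt⟩ := exists_fg_criticalExponent hd ht.1 ht.2 hε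
    obtain ⟨K, hK, hHK, hKt⟩ := exists_isBoomerang_criticalExponent hd hH hHt
    refine ⟨criticalExponent K, ⟨K, hK, rfl⟩, ?_⟩
    rw [dist_comm, Real.dist_eq, abs_of_nonneg (by linarith)]
    linarith

end Density

theorem corollary1p3 (d : ℕ) (hd : 1 ≤ d) :
    IsDenseIn (criticalExponent '' Boom d) (Set.Icc 0 (Real.log (2 * (d : ℝ) - 1))) ∧
    IsDenseIn (growthRate '' Boom d) (Set.Icc 1 (2 * (d : ℝ) - 1)) := by
  have hdense := isDenseIn_criticalExponent_boom d hd
  refine ⟨hdense, ?_⟩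
  have hq : (0 : ℝ) < 2 * d - 1 := by
    have : (1 : ℝ) ≤ d := by exact_mod_cast hd
    linarith
  have himage : growthRate '' Boom d = Real.exp '' (criticalExponent '' Boom d) :=
    (Set.image_image Real.exp criticalExponent (Boom d)).symm
  rw [himage]
  constructor
  · rintro _ ⟨t, ht, rfl⟩
    obtain ⟨h0, hlog⟩ := hdense.1 ht
    exact ⟨Real.one_le_exp h0, (Real.le_log_iff_exp_le hq).1 hlog⟩
  · intro x hx
    have hx0 : 0 < x := zero_lt_one.trans_le hx.1
    apply image_closure_subset_closure_image Real.continuous_exp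
    exact ⟨Real.log x, hdense.2 ⟨Real.log_nonneg hx.1, Real.log_le_log hx0 hx.2⟩, Real.exp_log hx0⟩
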